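/- **Model.** Fix SINR parameters: path loss $\alpha>2$, noise $\mathcal N>0$, threshold $\beta\ge 1$, sensitivity $\varepsilon>0$, and a common transmission power $P>0$. A network consists of $n\ge 2$ stations at distinct points of the Euclidean plane with distinct labels in $\{1,\dots,N\}$, where $N\le n^{p}$ for a fixed $p$. When $\mathcal T$ is the set of stations transmitting in a round, station $u\notin\mathcal T$ receives the message of $v\in\mathcal T$ iff $$P\,\mathrm{dist}(v,u)^{-\alpha}\ge(1+\varepsilon)\beta\mathcal N\quad\text{and}\quad \frac{P\,\mathrm{dist}(v,u)^{-\alpha}}{\mathcal N+\sum_{w\in\mathcal T\setminus\{v\}}P\,\mathrm{dist}(w,u)^{-\alpha}}\ge\beta .$$ Let $r=\bigl(P/((1+\varepsilon)\beta\mathcal N)\bigr)^{1/\alpha}$ be the communication range. The communication graph $G$ joins distinct stations at distance at most $r$; it is assumed connected, and $D$ is its diameter. The granularity $g$ is $r$ divided by the minimum distance between two stations. For $c>0$ let $G_c$ be the grid of half-open $c\times c$ boxes aligned with the axes with a corner at the origin; the pivotal grid is $G_\gamma$ with $\gamma=r/\sqrt2$. The leader of a box of $G_\gamma$ is its station of least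 label. **Problem.** A set $K$ of source stations holds $k\ge1$ distinct rumors in total (a station may hold several); every station must obtain all rumors. Rounds are synchronous and counted by a global clock. Protocols are deterministic; in the centralized setting the program of each station may depend on the whole network (all coordinates and labels) and on $k$, but not on which stations are sources: apart from this, a station acts only on the rumors it holds initially and on what it received in earlier rounds. Wake-up is non-spontaneous: a station outside $K$ cannot transmit before it has received a message. Messages have unit size: at most one rumor, which the transmitter already has, and $O(\log n)$ control bits. A backbone structure is a set $H$ of stations that induces a connected dominating subgraph of $G$ with diameter $O(D)$ (and $D=O(\operatorname{diam}(H)+1)$), contains the leader of each nonempty box of $G_\gamma$ and, for any two distinct boxes joined by an edge of $G$, two adjacent stations in these two boxes, has $O(1)$ stations in each box, and whose members can be scheduled in $O(1)$ rounds, by a dilution with a constant parameter $d$ (stations transmitting together have box coordinates congruent modulo $d$), so that each of them is received by all its neighbours. **Corollary.** There is a centralized protocol (Central-Gran-Dependent-Multicast) that in every such network and for all $k\ge1$ constructs a backbone structure $H$ (known to every station at the end) and accomplishes multi-broadcast with unit-size messages in the non-spontaneous wake-up setting in $O(D+k+\log g)$ rounds, after which it is silent, whatever the sources and their rumors. It runs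 in three phases. 1. *Leader election by grid halving.* Let $m$ be the least integer with $2^m\ge g$. There are $m$ stages of the same length $O(1)$. Initially exactly the sources are active; after stage $i$ ($0\le i\le m$) the active stations are exactly the sources of least label among the sources in their box of $G_{\gamma/2^{m-i}}$. Hence after $m$ stages each box of $G_\gamma$ that contains a source has exactly one active station. 2. *Gathering.* After $O(k)$ further rounds the leader of each box of $G_\gamma$ has all rumors that originate in this box. In phases 1 and 2 only sources transmit. 3. *Dissemination.* In $O(D+k)$ further rounds, in which only stations of $H$ transmit, every station receives all rumors. All implied constants depend only on $\alpha,\mathcal N,\beta,\varepsilon,P$ and $p$. -/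

import Mathlib

open scoped BigOperators

noncomputable section

namespace SINR

/-- The Euclidean plane. -/
abbrev Plane := EuclideanSpace ℝ (Fin 2)

/-- Parameters of the (uniform) SINR model: path loss `alpha`, ambient noise, reception
threshold `beta`, signal sensitivity `eps`, and the common transmission power. -/
structure Model where
  alpha : ℝ
  noise : ℝ
  beta : ℝ
  eps : ℝ
  power : ℝ
  two_lt_alpha : 2 < alpha
  noise_pos : 0 < noise
  one_le_beta : 1 ≤ beta
  eps_pos : 0 < eps
  power_pos : 0 < power

/-- Power at `y` of a signal sent from `x`. -/
def Model.signal (M : Model) (x y : Plane) : ℝ := M.power * dist x y ^ (-M.alpha)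

/-- The communication range: the largest distance `d` for which
`power * d ^ (-alpha) ≥ (1 + eps) * beta * noise`. -/
def Model.range (M : Model) : ℝ :=
  (M.power / ((1 + M.eps) * M.beta * M.noise)) ^ (1 / M.alpha)

/-- The side length of the boxes of the pivotal grid. -/
def Model.pivot (M : Model) : ℝ := M.range / √2

/-- Coordinates of the box of the grid `G_c` containing `x`: the pair `(i, j)` with
`c * i ≤ x 0 < c * (i + 1)` and `c * j ≤ x 1 < c * (j + 1)`. -/
def boxCoord (c : ℝ) (x : Plane) : ℤ × ℤ := (⌊x 0 / c⌋, ⌊x 1 / c⌋)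

/-- `n` stations at distinct points of the plane, with distinct labels from `{1, …, N}`. -/
structure Network (n N : ℕ) where
  pos : Fin n → Plane
  pos_injective : Function.Injective pos
  label : Fin n → ℕ
  label_injective : Function.Injective label
  label_mem : ∀ v, label v ∈ Finset.Icc 1 N

namespace Network

variable {n N : ℕ}

/-- The signal to interference and noise ratio at `u` of the transmission of `v`, when `T` is
the set of transmitting stations. -/
def sinr (net : Network n N) (M : Model) (T : Finset (Fin n)) (v u : Fin n) : ℝ :=
  M.signal (net.pos v) (net.pos u) /
    (M.noise + ∑ w ∈ T.erase v, M.signal (net.pos w) (net.pos u))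

/-- `u` successfully receives the transmission of `v` when `T` is the set of transmitting
stations. -/
def Receives (net : Network n N) (M : Model) (T : Finset (Fin n)) (v u : Fin n) : Prop :=
  v ∈ T ∧ u ∉ T ∧
    (1 + M.eps) * M.beta * M.noise ≤ M.signal (net.pos v) (net.pos u) ∧
    M.beta ≤ net.sinr M T v u

/-- At most one transmission can be received by a station in a round. -/
theorem Receives.unique {net : Network n N} {M : Model} {T : Finset (Fin n)} {v w u : Fin n}
    (hv : net.Receives M T v u) (hw : net.Receives M T w u) : v = w := by
  by_contra hne
  have nonneg : ∀ a b, 0 ≤ M.signal a b := fun a b =>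
    mul_nonneg M.power_pos.le (Real.rpow_nonneg dist_nonneg _)
  have key : ∀ a b : Fin n, a ≠ b → net.Receives M T a u → b ∈ T →
      M.signal (net.pos b) (net.pos u) < M.signal (net.pos a) (net.pos u) := by
    intro a b hab ha hb
    have hs : M.signal (net.pos b) (net.pos u) ≤
        ∑ x ∈ T.erase a, M.signal (net.pos x) (net.pos u) :=
      Finset.single_le_sum (f := fun x => M.signal (net.pos x) (net.pos u))
        (fun x _ => nonneg _ _) (Finset.mem_erase.2 ⟨hab.symm, hb⟩)
    have hpos : 0 < M.noise + ∑ x ∈ T.erase a, M.signal (net.pos x) (net.pos u) := by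
      have := nonneg (net.pos b) (net.pos u)
      have := M.noise_pos
      linarith
    have h1 : 1 ≤ net.sinr M T a u := M.one_le_beta.trans ha.2.2.2
    rw [sinr, le_div_iff₀ hpos] at h1
    have := M.noise_pos
    linarith
  exact lt_asymm (key v w hne hv hw.1) (key w v (Ne.symm hne) hw hv.1)

/-- The communication graph: distinct stations within range of each other. -/
def commGraph (net : Network n N) (M : Model) : SimpleGraph (Fin n) where
  Adj u v := u ≠ v ∧ dist (net.pos u) (net.pos v) ≤ M.range
  symm := ⟨fun _ _ h => ⟨h.1.symm, by rw [dist_comm]; exact h.2⟩⟩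
  loopless := ⟨fun _ h => h.1 rfl⟩

/-- The smallest distance between two stations (used for at least two stations). -/
def minDist (net : Network n N) : ℝ :=
  sInf {d | ∃ u v : Fin n, u ≠ v ∧ d = dist (net.pos u) (net.pos v)}

/-- The granularity of the network. -/
def granularity (net : Network n N) (M : Model) : ℝ := M.range / net.minDist

/-- The least `i` with `2 ^ i ≥ g`, where `g` is the granularity. -/
def levels (net : Network n N) (M : Model) : ℕ := sInf {i : ℕ | net.granularity M ≤ 2 ^ i}

/-- The box of the pivotal grid containing the station `v`. -/
def box (net : Network n N) (M : Model) (v : Fin n) : ℤ × ℤ := boxCoord M.pivot (net.pos v)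

/-- `v` has the least label among all stations in its box of the pivotal grid. -/
def IsBoxLeader (net : Network n N) (M : Model) (v : Fin n) : Prop :=
  ∀ u, net.box M u = net.box M v → net.label v ≤ net.label u

/-- Any two stations of `A` have grid coordinates (in the pivotal grid) that are congruent
modulo `d`. -/
def Diluted (net : Network n N) (M : Model) (d : ℕ) (A : Finset (Fin n)) : Prop :=
  ∀ u ∈ A, ∀ v ∈ A, (net.box M u).1 ≡ (net.box M v).1 [ZMOD d] ∧
    (net.box M u).2 ≡ (net.box M v).2 [ZMOD d]

open Classical in
/-- `H` is a backbone structure, with all implied constants bounded by `B`: a connected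
dominating set of the communication graph with asymptotically the same diameter, which contains
the leader of each box of the pivotal grid and connects each pair of neighbouring boxes, has a
bounded number of stations in each box, and all of whose members can successfully transmit
(to all their neighbours) in a bounded number of rounds, with a dilution. -/
structure IsBackbone (net : Network n N) (M : Model) (B : ℕ) (H : Finset (Fin n)) : Prop where
  connected : ((net.commGraph M).induce (H : Set (Fin n))).Connected
  dominating : ∀ v, v ∈ H ∨ ∃ u ∈ H, (net.commGraph M).Adj u v
  diam_le : ((net.commGraph M).induce (H : Set (Fin n))).diam ≤ B * (net.commGraph M).diam
  le_diam : (net.commGraph M).diam ≤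
    B * (((net.commGraph M).induce (H : Set (Fin n))).diam + 1)
  leader_mem : ∀ v, net.IsBoxLeader M v → v ∈ H
  helpers : ∀ u v, (net.commGraph M).Adj u v → net.box M u ≠ net.box M v →
    ∃ u' ∈ H, ∃ v' ∈ H, net.box M u' = net.box M u ∧ net.box M v' = net.box M v ∧
      (net.commGraph M).Adj u' v'
  card_box_le : ∀ C : ℤ × ℤ, (H.filter fun u => net.box M u = C).card ≤ B
  schedule : ∃ d : ℕ, 0 < d ∧ d ≤ B ∧ ∃ slot : Fin n → Fin B, ∀ s : Fin B,
    net.Diluted M d (H.filter fun u => slot u = s) ∧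
    ∀ v ∈ H, slot v = s → ∀ u, (net.commGraph M).Adj v u →
      net.Receives M (H.filter fun u => slot u = s) v u

end Network

/-- A message: at most one rumor, together with some control bits. -/
structure Message (R : Type) where
  rumor : Option R
  control : List Bool

/-- What a station has observed: its own initial rumors and, for each past round in order, the
message it received in that round, if any. In particular the length of `received` is the number
of the current round (rounds are counted by a global clock, from `0`). -/
structure LocalView (R : Type) where
  initial : Set R
  received : List (Option (Message R))

/-- A deterministic protocol for `n` stations: each station decides from its own view alone
whether to transmit in the current round and what. Its view also determines two local outputs:
whether it is currently an active candidate in the election of leaders among the sources, and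
the backbone it has computed. -/
structure Protocol (n : ℕ) (R : Type) where
  transmit : Fin n → LocalView R → Option (Message R)
  active : Fin n → LocalView R → Prop
  backbone : Fin n → LocalView R → Finset (Fin n)

/-- In the centralized setting the program of each station may depend on the whole network
(coordinates and labels of all stations) and on the number `k` of rumors, but not on which
stations are sources. -/
def CentralizedProtocol (R : Type) : Type :=
  ∀ n N : ℕ, Network n N → ℕ → Protocol n R

/-- An input of the multi-broadcast problem: `k` distinct rumors, held by arbitrary stations.
One station may hold several rumors. -/
structure Input (n k : ℕ) (R : Type) where
  holder : Fin k → Fin n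
  rumor : Fin k → R
  rumor_injective : Function.Injective rumor

/-- The set `K` of source stations. -/
def Input.sources {n k : ℕ} {R : Type} (I : Input n k R) : Set (Fin n) := Set.range I.holder

/-- The rumors initially held by a station. -/
def Input.initial {n k : ℕ} {R : Type} (I : Input n k R) (v : Fin n) : Set R :=
  {x | ∃ i, I.holder i = v ∧ I.rumor i = x}

namespace Protocol

variable {n k N : ℕ} {R : Type}

open Classical in
/-- What `v` transmits, given its receptions so far. Non-spontaneous wake-up: a station that is
no source and has not yet received a message is asleep and does not transmit. -/
def action (P : Protocol n R) (I : Input n k R) (v : Fin n)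
    (received : List (Option (Message R))) : Option (Message R) :=
  if v ∈ I.sources ∨ ∃ m, some m ∈ received then P.transmit v ⟨I.initial v, received⟩ else none

open Classical in
/-- What `u` receives in a round in which each station `v` transmits `sent v`. -/
def reception (net : Network n N) (M : Model) (sent : Fin n → Option (Message R)) (u : Fin n) :
    Option (Message R) :=
  if h : ∃ v, net.Receives M (Finset.univ.filter fun w => (sent w).isSome = true) v u
  then sent h.choose else none

/-- The receptions of each station in the rounds `0, …, t - 1`. -/
def history (P : Protocol n R) (net : Network n N) (M : Model) (I : Input n k R) :
    ℕ → Fin n → List (Option (Message R))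
  | 0, _ => []
  | t + 1, u => history P net M I t u ++
      [reception net M (fun v => P.action I v (history P net M I t v)) u]

/-- The view of `v` after `t` rounds. -/
def view (P : Protocol n R) (net : Network n N) (M : Model) (I : Input n k R) (t : ℕ)
    (v : Fin n) : LocalView R :=
  ⟨I.initial v, P.history net M I t v⟩

/-- What `v` transmits in round `t`. -/
def sent (P : Protocol n R) (net : Network n N) (M : Model) (I : Input n k R) (t : ℕ)
    (v : Fin n) : Option (Message R) :=
  P.action I v (P.history net M I t v)

/-- The rumors that `v` holds or has received after `t` rounds. -/
def known (P : Protocol n R) (net : Network n N) (M : Model) (I : Input n k R) (t : ℕ)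
    (v : Fin n) : Set R :=
  I.initial v ∪ {x | ∃ m, some m ∈ P.history net M I t v ∧ m.rumor = some x}

/-- Unit-size messages: each transmitted message has at most `c * ⌊log₂ n⌋` control bits, and the
rumor in it, if there is one, is an original rumor that the transmitter already has. -/
def UnitSize (P : Protocol n R) (net : Network n N) (M : Model) (I : Input n k R) (c : ℕ) :
    Prop :=
  ∀ t v m, P.sent net M I t v = some m →
    m.control.length ≤ c * Nat.log 2 n ∧ ∀ x, m.rumor = some x → x ∈ P.known net M I t v

/-- Leader election by grid halving, in stages of `L` rounds. After stage `i`, where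
`0 ≤ i ≤ m = levels`, the active stations are the sources of least label among the sources in
their box of the grid of side `γ / 2 ^ (m - i)`, where `γ` is the side of the pivotal grid.
So all sources are active at first (there is at most one station in a box of the finest grid),
each stage doubles the side of the boxes, and after `m` stages there is exactly one leader in each
box of the pivotal grid that contains a source. -/
def ElectsByGridHalving (P : Protocol n R) (net : Network n N) (M : Model) (I : Input n k R)
    (L : ℕ) : Prop :=
  (∀ v, P.active v (P.view net M I 0 v) ↔ v ∈ I.sources) ∧
  ∀ i ≤ net.levels M, ∀ v, P.active v (P.view net M I (L * i) v) ↔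
    v ∈ I.sources ∧ ∀ u ∈ I.sources,
      boxCoord (M.pivot / 2 ^ (net.levels M - i)) (net.pos u) =
        boxCoord (M.pivot / 2 ^ (net.levels M - i)) (net.pos v) → net.label v ≤ net.label u

/-- After `t` rounds the leader of each box has all rumors that originate in the box. -/
def GathersBy (P : Protocol n R) (net : Network n N) (M : Model) (I : Input n k R) (t : ℕ) :
    Prop :=
  ∀ v, net.IsBoxLeader M v → ∀ i, net.box M (I.holder i) = net.box M v →
    I.rumor i ∈ P.known net M I t v

/-- Multi-broadcast is accomplished after `t` rounds: each station has all the rumors. -/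
def MultiBroadcastBy (P : Protocol n R) (net : Network n N) (M : Model) (I : Input n k R)
    (t : ℕ) : Prop :=
  ∀ v i, I.rumor i ∈ P.known net M I t v

end Protocol

end SINR

end

noncomputable section

/-! ### Grid geometry and the interference bound -/

namespace SINR

/-! Everything rests on one scale-free interference bound, `exists_sufficientDilution`. If the
transmitters occupy distinct boxes of side `s` with coordinates congruent modulo `d`, their box
offsets from one of them, divided by `d`, are distinct nonzero vectors `z` of `ℤ²`. Within distance
`3 * s` of that transmitter the interference is thus at most a constant times `(s * d) ^ (-α) * ∑
‖z‖ ^ (-α)`, a convergent lattice sum because `α > 2`. The wanted signal is at least `P * (3 * s) ^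
(-α)`, so `s` cancels, one `d` serves all grids, and the slack `ε` pays for the interference. Hence
`d ^ 2` rounds, one per residue class, let one station per box be heard.

Election: a finest box holds at most one station. In each stage the leader of a subbox announces
itself together with the number of sources in its subbox; the four siblings use different slots and
are heard in the whole merged box (`stageInvariant`). At no extra cost each source thus learns its
rank: the sum, over the stages, of the counts of lexicographically earlier siblings. Ranks number
the sources of a pivotal box without repetition or gap (`eq_of_rank_eq`, `exists_rank_eq`).

Gathering: the sources of a box speak in rank order, and the last rumor of each carries the rank of
its successor as a token. No step is idle until the box has finished, so `k` steps suffice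
(`turnInvariant`, `gathersBy`).

Dissemination: the backbone consists of the box leaders and the ends of one edge for each ordered
pair of boxes joined by an edge. It has at most 51 stations per box, and each edge of the
communication graph costs at most three edges between leaders. Flooding along it is pipelined: along
a walk each vertex lags one step behind its predecessor, having forwarded either the given rumor or
enough others, so `5 * D + k` steps suffice (`mem_forwarded_of_walk`). -/

theorem abs_coord_sub_le_dist (x y : Plane) (i : Fin 2) : |x i - y i| ≤ dist x y := by
  rw [EuclideanSpace.dist_eq, Fin.sum_univ_two]
  apply Real.le_sqrt_of_sq_le
  rw [sq_abs]
  fin_cases i <;> simp [Real.dist_eq, sq_abs] <;> positivity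

theorem dist_lt_of_abs_coord_sub_lt {x y : Plane} {a : ℝ} (h : ∀ i, |x i - y i| < a) :
    dist x y < √2 * a := by
  have ha : 0 < a := (abs_nonneg _).trans_lt (h 0)
  rw [EuclideanSpace.dist_eq, Fin.sum_univ_two, ← Real.sqrt_sq ha.le,
    ← Real.sqrt_mul (by norm_num)]
  apply Real.sqrt_lt_sqrt (by positivity)
  have h0 := pow_lt_pow_left₀ (h 0) (abs_nonneg _) two_ne_zero
  have h1 := pow_lt_pow_left₀ (h 1) (abs_nonneg _) two_ne_zero
  rw [Real.dist_eq, Real.dist_eq]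
  linarith

theorem dist_lt_of_boxCoord_eq {c : ℝ} (hc : 0 < c) {x y : Plane}
    (h : boxCoord c x = boxCoord c y) : dist x y < √2 * c := by
  rw [boxCoord, boxCoord, Prod.mk.injEq] at h
  have key : ∀ a b : ℝ, ⌊a / c⌋ = ⌊b / c⌋ → |a - b| < c := fun a b hab => by
    have := Int.abs_sub_lt_one_of_floor_eq_floor hab
    rw [← sub_div, abs_div, abs_of_pos hc, div_lt_one hc] at this
    exact this
  apply dist_lt_of_abs_coord_sub_lt
  intro i
  fin_cases i
  · exact key _ _ h.1
  · exact key _ _ h.2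

theorem abs_floor_sub_floor_le (a b : ℝ) : |((⌊a⌋ - ⌊b⌋ : ℤ) : ℝ)| ≤ |a - b| + 1 := by
  have h1 := Int.floor_le a
  have h2 := Int.lt_floor_add_one a
  have h3 := Int.floor_le b
  have h4 := Int.lt_floor_add_one b
  push_cast
  rw [abs_le]
  constructor
  · linarith [neg_abs_le (a - b)]
  · linarith [le_abs_self (a - b)]

theorem abs_boxCoord_sub_le {c : ℝ} (hc : 0 < c) (x y : Plane) :
    c * |(((boxCoord c x).1 - (boxCoord c y).1 : ℤ) : ℝ)| ≤ dist x y + c ∧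
      c * |(((boxCoord c x).2 - (boxCoord c y).2 : ℤ) : ℝ)| ≤ dist x y + c := by
  have key : ∀ i, c * |((⌊x i / c⌋ - ⌊y i / c⌋ : ℤ) : ℝ)| ≤ dist x y + c := fun i => by
    have h1 := abs_floor_sub_floor_le (x i / c) (y i / c)
    have h2 := abs_coord_sub_le_dist x y i
    rw [← sub_div, abs_div, abs_of_pos hc] at h1
    have h3 := mul_le_mul_of_nonneg_left h1 hc.le
    rw [mul_add, mul_div_cancel₀ _ hc.ne', mul_one] at h3
    linarith
  exact ⟨key 0, key 1⟩

/-- Both grids have a corner at the origin, so they are nested; this is what makes the boxes merge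
in groups of four during the halving. -/
theorem boxCoord_two_mul (c : ℝ) (x : Plane) :
    boxCoord (2 * c) x = ((boxCoord c x).1 / 2, (boxCoord c x).2 / 2) := by
  have key : ∀ a : ℝ, ⌊a / (2 * c)⌋ = ⌊a / c⌋ / 2 := fun a => by
    have := Int.floor_div_natCast (a / c) 2
    rw [mul_comm, ← div_div]
    exact_mod_cast this
  simp only [boxCoord, key]

theorem Model.threshold_pos (M : Model) : 0 < (1 + M.eps) * M.beta * M.noise := by
  have := M.eps_pos
  have := M.one_le_beta
  have := M.noise_pos
  have : 0 < M.beta := by linarith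
  positivity

theorem Model.range_pos (M : Model) : 0 < M.range :=
  Real.rpow_pos_of_pos (div_pos M.power_pos M.threshold_pos) _

theorem Model.pivot_pos (M : Model) : 0 < M.pivot := div_pos M.range_pos (by positivity)

theorem Model.sqrt_two_mul_pivot (M : Model) : √2 * M.pivot = M.range := by
  rw [Model.pivot]
  field_simp

theorem Model.alpha_pos (M : Model) : 0 < M.alpha := by linarith [M.two_lt_alpha]

/-- Distinctness matters: `0 ^ (-alpha)` is `0` for real powers, so the formal signal at distance
zero vanishes. -/
theorem Model.threshold_le_signal (M : Model) {x y : Plane} (hxy : x ≠ y)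
    (h : dist x y ≤ M.range) : (1 + M.eps) * M.beta * M.noise ≤ M.signal x y := by
  have hd : 0 < dist x y := dist_pos.2 hxy
  have hA := M.threshold_pos
  have h1 : dist x y ^ M.alpha ≤ M.power / ((1 + M.eps) * M.beta * M.noise) := by
    have h2 := Real.rpow_le_rpow hd.le h M.alpha_pos.le
    rwa [Model.range, ← Real.rpow_mul (div_pos M.power_pos hA).le,
      one_div_mul_cancel M.alpha_pos.ne', Real.rpow_one] at h2
  rw [le_div_iff₀ hA] at h1
  rw [Model.signal, Real.rpow_neg hd.le, ← div_eq_mul_inv,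
    le_div_iff₀ (Real.rpow_pos_of_pos hd _)]
  linarith

/-- A dilution factor `d` is sufficient if stations that transmit together from distinct boxes
of a grid of side `s`, with coordinates congruent modulo `d`, are received by every station
within the range and within distance `3 * s`. -/
def SufficientDilution (M : Model) (d : ℕ) : Prop :=
  ∀ (n N : ℕ) (net : Network n N) (s : ℝ) (T : Finset (Fin n)) (v u : Fin n), 0 < s →
    (∀ w ∈ T, ∀ w' ∈ T, boxCoord s (net.pos w) = boxCoord s (net.pos w') → w = w') →
    (∀ w ∈ T, ∀ w' ∈ T,
      (boxCoord s (net.pos w)).1 ≡ (boxCoord s (net.pos w')).1 [ZMOD d] ∧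
      (boxCoord s (net.pos w)).2 ≡ (boxCoord s (net.pos w')).2 [ZMOD d]) →
    v ∈ T → u ≠ v → dist (net.pos v) (net.pos u) ≤ M.range →
    dist (net.pos v) (net.pos u) ≤ 3 * s → net.Receives M T v u

/-- The vector by which the box of `y` is displaced from that of `x`, in units of `d` boxes. -/
def boxShift (s : ℝ) (d : ℕ) (x y : Plane) : Fin 2 → ℤ :=
  ![((boxCoord s y).1 - (boxCoord s x).1) / d, ((boxCoord s y).2 - (boxCoord s x).2) / d]

section boxShift

variable {s : ℝ} {d : ℕ} {x y : Plane}

theorem mul_boxShift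
    (h : (boxCoord s x).1 ≡ (boxCoord s y).1 [ZMOD d] ∧
      (boxCoord s x).2 ≡ (boxCoord s y).2 [ZMOD d]) :
    (d : ℤ) * boxShift s d x y 0 = (boxCoord s y).1 - (boxCoord s x).1 ∧
      (d : ℤ) * boxShift s d x y 1 = (boxCoord s y).2 - (boxCoord s x).2 :=
  ⟨Int.mul_ediv_cancel' h.1.dvd, Int.mul_ediv_cancel' h.2.dvd⟩

/-- In the coordinate attaining the sup norm the boxes are `d * ‖z‖` apart, and points in boxes `m`
apart are at distance at least `s * (m - 1)`. -/
theorem mul_norm_boxShift_le (hs : 0 < s) (hd : 0 < d)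
    (h : (boxCoord s x).1 ≡ (boxCoord s y).1 [ZMOD d] ∧
      (boxCoord s x).2 ≡ (boxCoord s y).2 [ZMOD d]) :
    s * (d * ‖boxShift s d x y‖) ≤ dist y x + s := by
  have hd' : (0 : ℝ) < d := by exact_mod_cast hd
  obtain ⟨h0, h1⟩ := mul_boxShift h
  obtain ⟨g0, g1⟩ := abs_boxCoord_sub_le hs y x
  have key : ‖boxShift s d x y‖ ≤ (dist y x + s) / (s * d) := by
    rw [pi_norm_le_iff_of_nonneg (by positivity)]
    intro i
    rw [le_div_iff₀ (by positivity), Int.norm_eq_abs]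
    fin_cases i
    · rw [← h0] at g0
      push_cast at g0
      rw [abs_mul, abs_of_pos hd'] at g0
      calc _ = s * (d * |(boxShift s d x y 0 : ℝ)|) := by
            simp only [Fin.zero_eta]; ring
        _ ≤ _ := g0
    · rw [← h1] at g1
      push_cast at g1
      rw [abs_mul, abs_of_pos hd'] at g1
      calc _ = s * (d * |(boxShift s d x y 1 : ℝ)|) := by
            simp only [Fin.mk_one]; ring
        _ ≤ _ := g1
  rw [le_div_iff₀ (by positivity)] at key
  linarith

/-- With one transmitter per box, the shift determines the transmitter, so a sum over transmitters
becomes a sum over distinct lattice points. -/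
theorem boxCoord_eq_of_boxShift_eq {z : Plane}
    (h : (boxCoord s x).1 ≡ (boxCoord s y).1 [ZMOD d] ∧
      (boxCoord s x).2 ≡ (boxCoord s y).2 [ZMOD d])
    (h' : (boxCoord s x).1 ≡ (boxCoord s z).1 [ZMOD d] ∧
      (boxCoord s x).2 ≡ (boxCoord s z).2 [ZMOD d])
    (hyz : boxShift s d x y = boxShift s d x z) : boxCoord s y = boxCoord s z := by
  obtain ⟨h0, h1⟩ := mul_boxShift h
  obtain ⟨g0, g1⟩ := mul_boxShift h'
  rw [hyz] at h0 h1
  ext <;> linarith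

theorem one_le_norm_boxShift
    (h : (boxCoord s x).1 ≡ (boxCoord s y).1 [ZMOD d] ∧
      (boxCoord s x).2 ≡ (boxCoord s y).2 [ZMOD d])
    (hxy : boxCoord s x ≠ boxCoord s y) : 1 ≤ ‖boxShift s d x y‖ := by
  have hne : boxShift s d x y ≠ 0 := fun h0 => hxy
    (boxCoord_eq_of_boxShift_eq ⟨rfl, rfl⟩ h (by rw [h0]; ext i; fin_cases i <;> simp [boxShift]))
  obtain ⟨i, hi⟩ := Function.ne_iff.1 hne
  refine le_trans ?_ (norm_le_pi_norm _ i)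
  rw [Int.norm_eq_abs]
  exact_mod_cast Int.one_le_abs hi

end boxShift

theorem exists_sufficientDilution (M : Model) : ∃ d : ℕ, 8 ≤ d ∧ SufficientDilution M d := by
  set S : ℝ := ∑' z : Fin 2 → ℤ, ‖z‖ ^ (-M.alpha) with hS
  have hsum := EisensteinSeries.summable_one_div_norm_rpow M.two_lt_alpha
  have heps := M.eps_pos
  have hbeta : 0 < M.beta := by linarith [M.one_le_beta]
  have hP := M.power_pos
  have hα := M.alpha_pos
  -- After multiplication by `beta`, noise takes at most the share `1 / (1 + eps)` of the signal,
  -- which leaves `eps / (1 + eps)` for interference. The factor `3 ^ (-alpha)` is the attenuation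
  -- at distance `3 * s`.
  obtain ⟨d, hd8, hd⟩ : ∃ d : ℕ, 8 ≤ d ∧
      ((d : ℝ) / 2) ^ (-M.alpha) * S < (3 : ℝ) ^ (-M.alpha) * (M.eps / ((1 + M.eps) * M.beta)) := by
    have ht : Filter.Tendsto (fun d : ℕ => ((d : ℝ) / 2) ^ (-M.alpha) * S) Filter.atTop
        (nhds (0 * S)) :=
      ((tendsto_rpow_neg_atTop hα).comp
        (tendsto_natCast_atTop_atTop.atTop_div_const (by norm_num))).mul_const S
    rw [zero_mul] at ht
    have h := (ht.eventually_lt_const (u := (3 : ℝ) ^ (-M.alpha) *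
      (M.eps / ((1 + M.eps) * M.beta))) (by positivity)).and (Filter.eventually_ge_atTop 8)
    obtain ⟨d, h1, h2⟩ := h.exists
    exact ⟨d, h2, h1⟩
  refine ⟨d, hd8, ?_⟩
  intro n N net s T v u hs hT hmod hv huv hr h3
  have hd0 : 0 < d := by omega
  have hdR : (8 : ℝ) ≤ d := by exact_mod_cast hd8
  have hne : net.pos v ≠ net.pos u := fun h => huv (net.pos_injective h).symm
  have hduv : 0 < dist (net.pos v) (net.pos u) := dist_pos.2 hne
  have far : ∀ w ∈ T, w ≠ v →
      1 ≤ ‖boxShift s d (net.pos v) (net.pos w)‖ ∧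
      s * (d / 2 * ‖boxShift s d (net.pos v) (net.pos w)‖) ≤ dist (net.pos w) (net.pos u) := by
    intro w hw hwv
    have h1 := one_le_norm_boxShift (hmod v hv w hw) (fun h => hwv (hT v hv w hw h).symm)
    have h2 := mul_norm_boxShift_le hs hd0 (hmod v hv w hw)
    have h4 := dist_triangle_right (net.pos w) (net.pos v) (net.pos u)
    refine ⟨h1, ?_⟩
    -- The positions inside the boxes cost `s` and the distance from `v` to `u` costs `3 * s`; with
    -- `d ≥ 8` this total `4 * s` is at most half of the displacement.
    have h5 : s * 8 ≤ s * (d * ‖boxShift s d (net.pos v) (net.pos w)‖) := by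
      apply mul_le_mul_of_nonneg_left _ hs.le
      nlinarith
    linarith
  have huT : u ∉ T := by
    intro hu
    obtain ⟨h1, h2⟩ := far u hu huv
    rw [dist_self] at h2
    have : 0 < s * (d / 2 * ‖boxShift s d (net.pos v) (net.pos u)‖) := by positivity
    linarith
  have hsig := M.threshold_le_signal hne hr
  refine ⟨hv, huT, hsig, ?_⟩
  set sig := M.signal (net.pos v) (net.pos u) with hsigdef
  have hsig0 : M.power * (s ^ (-M.alpha) * 3 ^ (-M.alpha)) ≤ sig := by
    rw [hsigdef, Model.signal, ← Real.mul_rpow hs.le (by norm_num), mul_comm s 3]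
    exact mul_le_mul_of_nonneg_left (Real.rpow_le_rpow_of_nonpos hduv h3 (by linarith)) hP.le
  have hI : ∑ w ∈ T.erase v, M.signal (net.pos w) (net.pos u) ≤
      M.power * s ^ (-M.alpha) * ((d / 2) ^ (-M.alpha) * S) := by
    calc ∑ w ∈ T.erase v, M.signal (net.pos w) (net.pos u)
        ≤ ∑ w ∈ T.erase v, M.power * s ^ (-M.alpha) * ((d / 2) ^ (-M.alpha) *
            ‖boxShift s d (net.pos v) (net.pos w)‖ ^ (-M.alpha)) := by
          apply Finset.sum_le_sum
          intro w hw
          obtain ⟨hwv, hw⟩ := Finset.mem_erase.1 hw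
          obtain ⟨h1, h2⟩ := far w hw hwv
          rw [Model.signal, mul_assoc, ← Real.mul_rpow (by positivity) (by positivity),
            ← Real.mul_rpow hs.le (by positivity)]
          exact mul_le_mul_of_nonneg_left
            (Real.rpow_le_rpow_of_nonpos (by positivity) h2 (by linarith)) hP.le
      _ = M.power * s ^ (-M.alpha) * ((d / 2) ^ (-M.alpha) *
            ∑ w ∈ T.erase v, ‖boxShift s d (net.pos v) (net.pos w)‖ ^ (-M.alpha)) := by
          rw [Finset.mul_sum, Finset.mul_sum]
      _ ≤ _ := by
          have h0 : 0 ≤ s ^ (-M.alpha) := Real.rpow_nonneg hs.le _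
          apply mul_le_mul_of_nonneg_left _ (by positivity)
          apply mul_le_mul_of_nonneg_left _ (by positivity)
          -- Shifts are injective on the transmitters, so the finite sum is part of the full lattice
          -- sum.
          rw [← Finset.sum_image (f := fun z => ‖z‖ ^ (-M.alpha))
            (g := fun w => boxShift s d (net.pos v) (net.pos w))]
          · exact hsum.sum_le_tsum _ fun z _ => by positivity
          · intro w hw w' hw' h
            have hw := Finset.mem_of_mem_erase hw
            have hw' := Finset.mem_of_mem_erase hw'
            exact hT w hw w' hw'
              (boxCoord_eq_of_boxShift_eq (hmod v hv w hw) (hmod v hv w' hw') h)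
  have hI0 : 0 ≤ ∑ w ∈ T.erase v, M.signal (net.pos w) (net.pos u) :=
    Finset.sum_nonneg fun w _ => mul_nonneg hP.le (Real.rpow_nonneg dist_nonneg _)
  have hI' : ∑ w ∈ T.erase v, M.signal (net.pos w) (net.pos u) ≤
      sig * (M.eps / ((1 + M.eps) * M.beta)) := by
    refine hI.trans ?_
    calc _ ≤ M.power * s ^ (-M.alpha) *
          ((3 : ℝ) ^ (-M.alpha) * (M.eps / ((1 + M.eps) * M.beta))) :=
          mul_le_mul_of_nonneg_left hd.le (mul_nonneg hP.le (Real.rpow_nonneg hs.le _))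
      _ = M.power * (s ^ (-M.alpha) * 3 ^ (-M.alpha)) * (M.eps / ((1 + M.eps) * M.beta)) := by
          ring
      _ ≤ _ := mul_le_mul_of_nonneg_right hsig0 (by positivity)
  rw [Network.sinr, le_div_iff₀ (by linarith [M.noise_pos])]
  have e1 : M.beta * M.noise ≤ sig / (1 + M.eps) := by
    rw [le_div_iff₀ (by positivity)]
    linarith
  have e2 : M.beta * (sig * (M.eps / ((1 + M.eps) * M.beta))) = sig * M.eps / (1 + M.eps) := by
    field_simp
  have e3 := mul_le_mul_of_nonneg_left hI' hbeta.le
  have e4 : sig / (1 + M.eps) + sig * M.eps / (1 + M.eps) = sig := by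
    field_simp
  rw [mul_add]
  linarith

end SINR

/-! ### Residue slots and the backbone -/

namespace SINR

/-- The number of the residue class modulo `d` of a box, among the `d ^ 2` classes. -/
def residueSlot (d : ℕ) (c : ℤ × ℤ) : ℕ := (c.1 % d).toNat * d + (c.2 % d).toNat

theorem residueSlot_lt {d : ℕ} (hd : 0 < d) (c : ℤ × ℤ) : residueSlot d c < d ^ 2 := by
  have h1 := Int.emod_lt_of_pos c.1 (by exact_mod_cast hd : (0 : ℤ) < d)
  have h2 := Int.emod_lt_of_pos c.2 (by exact_mod_cast hd : (0 : ℤ) < d)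
  have h3 : (c.1 % d).toNat + 1 ≤ d := by omega
  have h4 : (c.2 % d).toNat < d := by omega
  have := Nat.mul_le_mul_right d h3
  rw [residueSlot]
  nlinarith

theorem modEq_of_residueSlot_eq {d : ℕ} (hd : 0 < d) {c c' : ℤ × ℤ}
    (h : residueSlot d c = residueSlot d c') : c.1 ≡ c'.1 [ZMOD d] ∧ c.2 ≡ c'.2 [ZMOD d] := by
  have hd' : (d : ℤ) ≠ 0 := by exact_mod_cast hd.ne'
  have key : ∀ c : ℤ × ℤ, (c.2 % d).toNat < d := fun c => by
    have h2 := Int.emod_lt_of_pos c.2 (by exact_mod_cast hd : (0 : ℤ) < d)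
    omega
  have h1 := congrArg (· / d) h
  have h2 := congrArg (· % d) h
  simp only [residueSlot, mul_comm _ d, Nat.mul_add_mod_self_left, Nat.mul_add_div hd,
    Nat.div_eq_of_lt (key _), Nat.mod_eq_of_lt (key _), add_zero] at h1 h2
  have := Int.emod_nonneg c.1 hd'
  have := Int.emod_nonneg c'.1 hd'
  have := Int.emod_nonneg c.2 hd'
  have := Int.emod_nonneg c'.2 hd'
  exact ⟨by rw [Int.ModEq]; omega, by rw [Int.ModEq]; omega⟩

namespace Network

variable {n N : ℕ} (net : Network n N) (M : Model)

theorem dist_le_range_of_box_eq {u v : Fin n} (h : net.box M u = net.box M v) :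
    dist (net.pos u) (net.pos v) ≤ M.range := by
  rw [← M.sqrt_two_mul_pivot]
  exact (dist_lt_of_boxCoord_eq M.pivot_pos h).le

/-- The factor 3 in `SufficientDilution` is chosen to cover both `√2` here and `2 * √2` for sibling
boxes in a halving stage. -/
theorem range_le_three_mul_pivot : M.range ≤ 3 * M.pivot := by
  rw [← M.sqrt_two_mul_pivot]
  have : √2 ≤ 3 := by rw [Real.sqrt_le_left (by norm_num)]; norm_num
  exact mul_le_mul_of_nonneg_right this M.pivot_pos.le

theorem exists_leader (v : Fin n) : ∃ w, net.box M w = net.box M v ∧ net.IsBoxLeader M w := by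
  classical
  obtain ⟨w, hw, hmin⟩ := Finset.exists_min_image
    (Finset.univ.filter fun w => net.box M w = net.box M v) net.label ⟨v, by simp⟩
  simp only [Finset.mem_filter, Finset.mem_univ, true_and] at hw hmin
  exact ⟨w, hw, fun u hu => hmin u (hu.trans hw)⟩

variable {net M} in
theorem IsBoxLeader.unique {v w : Fin n} (hv : net.IsBoxLeader M v) (hw : net.IsBoxLeader M w)
    (h : net.box M v = net.box M w) : v = w :=
  net.label_injective (le_antisymm (hv w h.symm) (hw v h))

/-- The leader of the box of `v`. -/
def leaderOf (v : Fin n) : Fin n := (net.exists_leader M v).choose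

theorem box_leaderOf (v : Fin n) : net.box M (net.leaderOf M v) = net.box M v :=
  (net.exists_leader M v).choose_spec.1

theorem isBoxLeader_leaderOf (v : Fin n) : net.IsBoxLeader M (net.leaderOf M v) :=
  (net.exists_leader M v).choose_spec.2

open Classical in
/-- A chosen edge of the communication graph from the box `A` to the box `A'`, if there is one. -/
def crossing (A A' : ℤ × ℤ) : Option (Fin n × Fin n) :=
  if h : ∃ e : Fin n × Fin n, net.box M e.1 = A ∧ net.box M e.2 = A' ∧
    (net.commGraph M).Adj e.1 e.2 then some h.choose else none

variable {net M} in
theorem crossing_spec {A A' : ℤ × ℤ} {e : Fin n × Fin n} (h : net.crossing M A A' = some e) :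
    net.box M e.1 = A ∧ net.box M e.2 = A' ∧ (net.commGraph M).Adj e.1 e.2 := by
  rw [crossing] at h
  split_ifs at h with h'
  rw [← Option.some.inj h]
  exact h'.choose_spec

theorem exists_crossing {u v : Fin n} (h : (net.commGraph M).Adj u v) :
    ∃ e, net.crossing M (net.box M u) (net.box M v) = some e := by
  have h' : ∃ e : Fin n × Fin n, net.box M e.1 = net.box M u ∧ net.box M e.2 = net.box M v ∧
    (net.commGraph M).Adj e.1 e.2 := ⟨(u, v), rfl, rfl, h⟩
  exact ⟨_, dif_pos h'⟩

open Classical in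
/-- The backbone: all box leaders, and both ends of a chosen edge for each pair of boxes joined
by an edge. -/
def backbone : Finset (Fin n) := Finset.univ.filter fun w => net.IsBoxLeader M w ∨
  ∃ A' e, (net.crossing M (net.box M w) A' = some e ∧ e.1 = w) ∨
    (net.crossing M A' (net.box M w) = some e ∧ e.2 = w)

theorem leaderOf_mem_backbone (v : Fin n) : net.leaderOf M v ∈ net.backbone M := by
  simp [backbone, net.isBoxLeader_leaderOf M v]

variable {net M} in
theorem crossing_mem_backbone {A A' : ℤ × ℤ} {e : Fin n × Fin n}
    (h : net.crossing M A A' = some e) : e.1 ∈ net.backbone M ∧ e.2 ∈ net.backbone M := by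
  obtain ⟨h1, h2, -⟩ := crossing_spec h
  simp only [backbone, Finset.mem_filter, Finset.mem_univ, true_and]
  exact ⟨.inr ⟨A', e, .inl ⟨by rw [h1]; exact h, rfl⟩⟩, .inr ⟨A, e, .inr ⟨by rw [h2]; exact h, rfl⟩⟩⟩

variable {net M} in
-- An edge has length at most `√2` box sides, so each coordinate changes by at most `√2 + 1 < 3`.
theorem box_sub_mem_of_adj {u v : Fin n} (h : (net.commGraph M).Adj u v) :
    net.box M v - net.box M u ∈ Finset.Icc (-2 : ℤ) 2 ×ˢ Finset.Icc (-2 : ℤ) 2 := by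
  have hp := M.pivot_pos
  obtain ⟨h1, h2⟩ := abs_boxCoord_sub_le hp (net.pos v) (net.pos u)
  have h3 : dist (net.pos v) (net.pos u) ≤ √2 * M.pivot := by
    rw [dist_comm, M.sqrt_two_mul_pivot]
    exact h.2
  have h4 : √2 < 2 := by rw [Real.sqrt_lt' (by norm_num)]; norm_num
  have key : ∀ a : ℤ, M.pivot * |(a : ℝ)| ≤ dist (net.pos v) (net.pos u) + M.pivot →
      a ∈ Finset.Icc (-2 : ℤ) 2 := by
    intro a ha
    have h5 : M.pivot * |(a : ℝ)| < M.pivot * 3 := by nlinarith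
    have h6 : |(a : ℝ)| < 3 := lt_of_mul_lt_mul_left h5 hp.le
    have h7 : |a| < 3 := by exact_mod_cast h6
    rw [abs_lt] at h7
    rw [Finset.mem_Icc]
    omega
  exact Finset.mem_product.2 ⟨key _ h1, key _ h2⟩

open Classical in
-- The bound is `51 = 1 + 25 + 25`: the leader, and for each of the 25 possible offsets one end of
-- the outgoing and one end of the incoming chosen edge.
theorem card_backbone_box_le (A : ℤ × ℤ) :
    ((net.backbone M).filter fun u => net.box M u = A).card ≤ 51 := by
  set O := Finset.Icc (-2 : ℤ) 2 ×ˢ Finset.Icc (-2 : ℤ) 2 with hO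
  have hOc : O.card = 25 := by rw [hO]; rfl
  have hsub : ((net.backbone M).filter fun u => net.box M u = A) ⊆
      (Finset.univ.filter fun u => net.IsBoxLeader M u ∧ net.box M u = A) ∪
      (O.biUnion (fun o => (net.crossing M A (A + o)).toFinset.image Prod.fst) ∪
      O.biUnion (fun o => (net.crossing M (A - o) A).toFinset.image Prod.snd)) := by
    intro w hw
    simp only [backbone, Finset.mem_filter, Finset.mem_univ, true_and] at hw
    obtain ⟨hw, rfl⟩ := hw
    simp only [Finset.mem_union, Finset.mem_filter, Finset.mem_univ, true_and, Finset.mem_biUnion,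
      Finset.mem_image, Option.mem_toFinset, Option.mem_def]
    rcases hw with hw | ⟨A', e, ⟨hw, h1⟩ | ⟨hw, h1⟩⟩
    · exact .inl ⟨hw, trivial⟩
    · obtain ⟨h2, h3, h4⟩ := crossing_spec hw
      refine .inr (.inl ⟨A' - net.box M w, ?_, e, by rw [add_sub_cancel]; exact hw, h1⟩)
      rw [← h3, ← h2]
      exact box_sub_mem_of_adj h4
    · obtain ⟨h2, h3, h4⟩ := crossing_spec hw
      refine .inr (.inr ⟨net.box M w - A', ?_, e, by rw [sub_sub_cancel]; exact hw, h1⟩)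
      rw [← h3, ← h2]
      exact box_sub_mem_of_adj h4
  have hone : ∀ (o : Option (Fin n × Fin n)) (f : Fin n × Fin n → Fin n),
      (o.toFinset.image f).card ≤ 1 := by
    intro o f
    refine Finset.card_image_le.trans ?_
    cases o <;> simp
  have hlead : (Finset.univ.filter fun u => net.IsBoxLeader M u ∧ net.box M u = A).card ≤ 1 := by
    rw [Finset.card_le_one]
    intro a ha b hb
    simp only [Finset.mem_filter, Finset.mem_univ, true_and] at ha hb
    exact ha.1.unique hb.1 (ha.2.trans hb.2.symm)
  have h1 := Finset.card_biUnion_le_card_mul O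
    (fun o => (net.crossing M A (A + o)).toFinset.image Prod.fst) 1 fun o _ => hone _ _
  have h2 := Finset.card_biUnion_le_card_mul O
    (fun o => (net.crossing M (A - o) A).toFinset.image Prod.snd) 1 fun o _ => hone _ _
  refine (Finset.card_le_card hsub).trans ((Finset.card_union_le _ _).trans ?_)
  have h3 := Finset.card_union_le
    (O.biUnion (fun o => (net.crossing M A (A + o)).toFinset.image Prod.fst))
    (O.biUnion (fun o => (net.crossing M (A - o) A).toFinset.image Prod.snd))
  omega

/-- The subgraph of the communication graph induced by the backbone. -/
abbrev backboneGraph : SimpleGraph ((net.backbone M : Finset (Fin n)) : Set (Fin n)) :=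
  (net.commGraph M).induce (net.backbone M : Set (Fin n))

theorem exists_backboneWalk_of_box_eq (u v : ((net.backbone M : Finset (Fin n)) : Set (Fin n)))
    (h : net.box M u = net.box M v) : ∃ w : (net.backboneGraph M).Walk u v, w.length ≤ 1 := by
  by_cases huv : u = v
  · subst huv
    exact ⟨.nil, by simp⟩
  · have hadj : (net.backboneGraph M).Adj u v :=
      ⟨fun h => huv (Subtype.ext h), net.dist_le_range_of_box_eq M h⟩
    exact ⟨hadj.toWalk, by simp⟩

/-- The leader of the box of `v`, as a vertex of the backbone. -/
def backboneLeader (v : Fin n) : ((net.backbone M : Finset (Fin n)) : Set (Fin n)) :=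
  ⟨net.leaderOf M v, net.leaderOf_mem_backbone M v⟩

/-- Each edge of the walk is replaced by at most three: from the leader to the near end of the
chosen crossing, across it, and on to the next leader. -/
theorem exists_backboneWalk {u v : Fin n} (w : (net.commGraph M).Walk u v) :
    ∃ w' : (net.backboneGraph M).Walk (net.backboneLeader M u) (net.backboneLeader M v),
      w'.length ≤ 3 * w.length := by
  induction w with
  | nil => exact ⟨.nil, by simp⟩
  | @cons a b c hab w ih =>
    obtain ⟨w', hw'⟩ := ih
    obtain ⟨e, he⟩ := net.exists_crossing M hab
    obtain ⟨h1, h2, h3⟩ := crossing_spec he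
    obtain ⟨m1, m2⟩ := crossing_mem_backbone he
    obtain ⟨p, hp⟩ := net.exists_backboneWalk_of_box_eq M (net.backboneLeader M a) ⟨e.1, m1⟩
      ((net.box_leaderOf M a).trans h1.symm)
    obtain ⟨q, hq⟩ := net.exists_backboneWalk_of_box_eq M ⟨e.2, m2⟩ (net.backboneLeader M b)
      (h2.trans (net.box_leaderOf M b).symm)
    have hadj : (net.backboneGraph M).Adj ⟨e.1, m1⟩ ⟨e.2, m2⟩ := h3
    refine ⟨p.append (.cons hadj (q.append w')), ?_⟩
    simp only [SimpleGraph.Walk.length_append, SimpleGraph.Walk.length_cons]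
    omega

variable {net M}

theorem exists_backboneWalk_le (hc : (net.commGraph M).Connected)
    (u v : ((net.backbone M : Finset (Fin n)) : Set (Fin n))) :
    ∃ w : (net.backboneGraph M).Walk u v, w.length ≤ 3 * (net.commGraph M).dist u v + 2 := by
  obtain ⟨w, hw⟩ := hc.exists_walk_length_eq_dist u v
  obtain ⟨w', hw'⟩ := net.exists_backboneWalk M w
  obtain ⟨p, hp⟩ := net.exists_backboneWalk_of_box_eq M u (net.backboneLeader M u)
    (net.box_leaderOf M u).symm
  obtain ⟨q, hq⟩ := net.exists_backboneWalk_of_box_eq M (net.backboneLeader M v) v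
    (net.box_leaderOf M v)
  refine ⟨p.append (w'.append q), ?_⟩
  simp only [SimpleGraph.Walk.length_append]
  omega

theorem backboneGraph_connected (hn : 0 < n) (hc : (net.commGraph M).Connected) :
    (net.backboneGraph M).Connected :=
  have : Nonempty ((net.backbone M : Finset (Fin n)) : Set (Fin n)) :=
    ⟨net.backboneLeader M ⟨0, hn⟩⟩
  ⟨fun u v => ⟨(exists_backboneWalk_le hc u v).choose⟩⟩

theorem ediam_ne_top (hn : 0 < n) (hc : (net.commGraph M).Connected) :
    (net.commGraph M).ediam ≠ ⊤ :=
  have : Nonempty (Fin n) := ⟨⟨0, hn⟩⟩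
  SimpleGraph.connected_iff_ediam_ne_top.1 hc

theorem diam_pos (hn : 2 ≤ n) (hc : (net.commGraph M).Connected) :
    0 < (net.commGraph M).diam :=
  have : Nontrivial (Fin n) := Fin.nontrivial_iff_two_le.2 hn
  Nat.pos_of_ne_zero (SimpleGraph.connected_iff_diam_ne_zero.1 hc)

theorem exists_backboneWalk_le_diam (hn : 2 ≤ n) (hc : (net.commGraph M).Connected)
    (u v : ((net.backbone M : Finset (Fin n)) : Set (Fin n))) :
    ∃ w : (net.backboneGraph M).Walk u v, w.length ≤ 5 * (net.commGraph M).diam := by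
  obtain ⟨w, hw⟩ := exists_backboneWalk_le hc u v
  have h1 := SimpleGraph.dist_le_diam (ediam_ne_top (by omega) hc) (u := u.1) (v := v.1)
  -- With at least two stations the diameter is positive, which absorbs the `2` extra edges at the
  -- ends.
  have h2 := diam_pos hn hc
  exact ⟨w, by omega⟩

theorem backboneGraph_diam_le (hn : 2 ≤ n) (hc : (net.commGraph M).Connected) :
    (net.backboneGraph M).diam ≤ 5 * (net.commGraph M).diam := by
  have := (backboneGraph_connected (by omega) hc).nonempty
  obtain ⟨u, v, h⟩ := (net.backboneGraph M).exists_dist_eq_diam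
  obtain ⟨w, hw⟩ := exists_backboneWalk_le_diam hn hc u v
  rw [← h]
  exact (SimpleGraph.dist_le w).trans hw

theorem exists_walk_of_box_eq {u v : Fin n} (h : net.box M u = net.box M v) :
    ∃ w : (net.commGraph M).Walk u v, w.length ≤ 1 := by
  by_cases huv : u = v
  · subst huv
    exact ⟨.nil, by simp⟩
  · have hadj : (net.commGraph M).Adj u v := ⟨huv, net.dist_le_range_of_box_eq M h⟩
    exact ⟨hadj.toWalk, by simp⟩

theorem diam_le_backboneGraph_diam (hn : 2 ≤ n) (hc : (net.commGraph M).Connected) :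
    (net.commGraph M).diam ≤ 2 * ((net.backboneGraph M).diam + 1) := by
  have : Nonempty (Fin n) := ⟨⟨0, by omega⟩⟩
  have hH := backboneGraph_connected (by omega) hc
  have := hH.nonempty
  obtain ⟨u, v, h⟩ := (net.commGraph M).exists_dist_eq_diam
  obtain ⟨w, hw⟩ := hH.exists_walk_length_eq_dist (net.backboneLeader M u) (net.backboneLeader M v)
  obtain ⟨p, hp⟩ := exists_walk_of_box_eq (net.box_leaderOf M u).symm
  obtain ⟨q, hq⟩ := exists_walk_of_box_eq (net.box_leaderOf M v)
  have h1 := SimpleGraph.dist_le_diam (SimpleGraph.connected_iff_ediam_ne_top.1 hH)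
    (u := net.backboneLeader M u) (v := net.backboneLeader M v)
  let w' : (net.commGraph M).Walk (net.leaderOf M u) (net.leaderOf M v) :=
    w.map (SimpleGraph.Embedding.induce _).toHom
  have hw' : w'.length = w.length := SimpleGraph.Walk.length_map _ _
  have h2 := SimpleGraph.dist_le (p.append (w'.append q))
  rw [SimpleGraph.Walk.length_append, SimpleGraph.Walk.length_append] at h2
  omega

variable (net M)

open Classical in
/-- The number of the member `v` of the backbone among the members in its box. -/
def backboneIndex (v : Fin n) : ℕ :=
  ((net.backbone M).filter fun u => net.box M u = net.box M v ∧ u < v).card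

theorem backboneIndex_lt {v : Fin n} (hv : v ∈ net.backbone M) : net.backboneIndex M v < 51 := by
  classical
  refine lt_of_lt_of_le (Finset.card_lt_card ?_) (net.card_backbone_box_le M (net.box M v))
  rw [Finset.ssubset_iff_of_subset fun u hu => by
    simp only [Finset.mem_filter] at hu ⊢
    exact ⟨hu.1, hu.2.1⟩]
  exact ⟨v, by simp [hv], by simp⟩

theorem eq_of_backboneIndex_eq {u v : Fin n} (hu : u ∈ net.backbone M) (hv : v ∈ net.backbone M)
    (hb : net.box M u = net.box M v) (h : net.backboneIndex M u = net.backboneIndex M v) :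
    u = v := by
  classical
  have key : ∀ u v : Fin n, u ∈ net.backbone M → net.box M u = net.box M v → u < v →
      net.backboneIndex M u < net.backboneIndex M v := by
    intro u v hu hb huv
    apply Finset.card_lt_card
    rw [Finset.ssubset_iff_of_subset fun w hw => by
      simp only [Finset.mem_filter] at hw ⊢
      exact ⟨hw.1, hw.2.1.trans hb, hw.2.2.trans huv⟩]
    exact ⟨u, by simp [hu, hb, huv], by simp⟩
  rcases lt_trichotomy u v with h1 | h1 | h1
  · exact absurd h (key u v hu hb h1).ne
  · exact h1
  · exact absurd h (key v u hv hb.symm h1).ne'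

/-- The slot of the member `v` of the backbone in the schedule of the backbone. -/
def backboneSlot (d : ℕ) (v : Fin n) : ℕ :=
  residueSlot d (net.box M v) + d ^ 2 * net.backboneIndex M v

theorem backboneSlot_lt {d : ℕ} (hd : 0 < d) {v : Fin n} (hv : v ∈ net.backbone M) :
    net.backboneSlot M d v < 51 * d ^ 2 := by
  have h1 := residueSlot_lt hd (net.box M v)
  have h2 := Nat.mul_le_mul_left (d ^ 2) (Nat.succ_le_of_lt (net.backboneIndex_lt M hv))
  rw [backboneSlot]
  rw [Nat.succ_eq_add_one, mul_add, mul_one] at h2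
  omega

variable {net M} in
theorem backboneSlot_eq {d : ℕ} (hd : 0 < d) {u v : Fin n}
    (h : net.backboneSlot M d u = net.backboneSlot M d v) :
    residueSlot d (net.box M u) = residueSlot d (net.box M v) ∧
      net.backboneIndex M u = net.backboneIndex M v := by
  have hd2 : 0 < d ^ 2 := by positivity
  have h1 := congrArg (· % d ^ 2) h
  have h2 := congrArg (· / d ^ 2) h
  simp only [backboneSlot, Nat.add_mul_mod_self_left, Nat.mod_eq_of_lt (residueSlot_lt hd _),
    Nat.add_mul_div_left _ _ hd2, Nat.div_eq_of_lt (residueSlot_lt hd _), zero_add] at h1 h2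
  exact ⟨h1, h2⟩

/-- A slot fixes the residue class and the index inside the box, so at most one member per box
transmits. Allowing any subset `T` of a slot matters in the dissemination, where members with
nothing to forward stay silent. -/
theorem receives_of_backboneSlot {d : ℕ} (hd : 0 < d) (hsuf : SufficientDilution M d)
    {T : Finset (Fin n)} (hT : T ⊆ net.backbone M)
    (hslot : ∀ u ∈ T, ∀ v ∈ T, net.backboneSlot M d u = net.backboneSlot M d v) {v u : Fin n}
    (hv : v ∈ T) (hvu : (net.commGraph M).Adj v u) : net.Receives M T v u := by
  refine hsuf n N net M.pivot T v u M.pivot_pos ?_ ?_ hv hvu.1.symm hvu.2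
    (hvu.2.trans (range_le_three_mul_pivot M))
  · intro w hw w' hw' h
    exact net.eq_of_backboneIndex_eq M (hT hw) (hT hw') h (backboneSlot_eq hd (hslot w hw w' hw')).2
  · intro w hw w' hw'
    exact modEq_of_residueSlot_eq hd (backboneSlot_eq hd (hslot w hw w' hw')).1

theorem isBackbone_backbone {d B : ℕ} (hd : 0 < d) (hsuf : SufficientDilution M d)
    (hB : 51 * d ^ 2 ≤ B) (hn : 2 ≤ n) (hc : (net.commGraph M).Connected) :
    net.IsBackbone M B (net.backbone M) := by
  classical
  have hdd : d ≤ d ^ 2 := Nat.le_self_pow two_ne_zero d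
  refine ⟨backboneGraph_connected (by omega) hc, ?_, ?_, ?_, ?_, ?_, ?_, d, hd, by omega, ?_⟩
  · intro v
    by_cases h : net.leaderOf M v = v
    · exact .inl (h ▸ net.leaderOf_mem_backbone M v)
    · exact .inr ⟨_, net.leaderOf_mem_backbone M v, h,
        net.dist_le_range_of_box_eq M (net.box_leaderOf M v)⟩
  · exact (backboneGraph_diam_le hn hc).trans (Nat.mul_le_mul_right _ (by omega))
  · exact (diam_le_backboneGraph_diam hn hc).trans (Nat.mul_le_mul_right _ (by omega))
  · intro v hv
    simp [backbone, hv]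
  · intro u v huv _
    obtain ⟨e, he⟩ := net.exists_crossing M huv
    obtain ⟨h1, h2, h3⟩ := crossing_spec he
    obtain ⟨m1, m2⟩ := crossing_mem_backbone he
    exact ⟨e.1, m1, e.2, m2, h1, h2, h3⟩
  · intro A
    have := net.card_backbone_box_le M A
    omega
  · have hB0 : 0 < B := by omega
    -- The reduction modulo `B` only makes the slot total on all stations; members have slots below
    -- `51 * d ^ 2 ≤ B`.
    refine ⟨fun v => ⟨net.backboneSlot M d v % B, Nat.mod_lt _ hB0⟩, fun s => ?_⟩
    have hslot : ∀ u ∈ (net.backbone M).filter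
          (fun v => (⟨net.backboneSlot M d v % B, Nat.mod_lt _ hB0⟩ : Fin B) = s),
        net.backboneSlot M d u = s := by
      intro u hu
      obtain ⟨hu, hs⟩ := Finset.mem_filter.1 hu
      rw [← hs]
      exact (Nat.mod_eq_of_lt ((net.backboneSlot_lt M hd hu).trans_le hB)).symm
    refine ⟨fun u hu v hv => ?_, fun v hv hs u hvu => ?_⟩
    · exact modEq_of_residueSlot_eq hd
        (backboneSlot_eq hd ((hslot u hu).trans (hslot v hv).symm)).1
    · exact net.receives_of_backboneSlot M hd hsuf (Finset.filter_subset _ _)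
        (fun a ha b hb => (hslot a ha).trans (hslot b hb).symm)
        (Finset.mem_filter.2 ⟨hv, hs⟩) hvu

end Network

end SINR

/-! ### Messages, the protocol and its runs -/

namespace SINR

variable {n N : ℕ} {R : Type}

/-- The message in which `v` announces the number `a` and possibly a rumor. -/
def announce (v : Fin n) (a : ℕ) (x : Option R) : Message R := ⟨x, Nat.bits (v + n * min a n)⟩

/-- The number encoded in the control bits of a message. -/
def Message.code (m : Message R) : ℕ := Nat.ofDigits 2 (m.control.map fun b => cond b 1 0)

/-- The sender of an announcement; the argument `v` is any station. -/
def Message.sender (m : Message R) (v : Fin n) : Fin n := ⟨m.code % n, Nat.mod_lt _ v.pos⟩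

/-- The number in an announcement. -/
def Message.arg (n : ℕ) (m : Message R) : ℕ := m.code / n

theorem code_announce (v : Fin n) (a : ℕ) (x : Option R) :
    (announce v a x).code = v + n * min a n := by
  rw [Message.code, announce, ← Nat.digits_two_eq_bits, Nat.ofDigits_digits]

@[simp]
theorem sender_announce (v u : Fin n) (a : ℕ) (x : Option R) :
    (announce v a x).sender u = v := by
  apply Fin.ext
  simp only [Message.sender, code_announce]
  rw [Nat.add_mul_mod_self_left, Nat.mod_eq_of_lt v.isLt]

theorem arg_announce (v : Fin n) {a : ℕ} (ha : a ≤ n) (x : Option R) :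
    (announce v a x).arg n = a := by
  rw [Message.arg, code_announce, min_eq_left ha, Nat.add_mul_div_left _ _ v.pos,
    Nat.div_eq_of_lt v.isLt, zero_add]

/-- The encoded number is below `n ^ 3`, and `log n + 1 ≤ 2 * log n` for `n ≥ 2`, whence `6`.
Capping `a` at `n` in `announce` makes this hold without knowing that the announced counts and ranks
are small. -/
theorem length_announce_le (hn : 2 ≤ n) (v : Fin n) (a : ℕ) (x : Option R) :
    (announce v a x).control.length ≤ 6 * Nat.log 2 n := by
  have h1 : 1 ≤ Nat.log 2 n := Nat.log_pos (by norm_num) hn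
  have h2 : n < 2 ^ (Nat.log 2 n + 1) := Nat.lt_pow_succ_log_self (by norm_num) n
  have h3 : v + n * min a n < n ^ 3 := by
    have := v.isLt
    have h4 : n * min a n ≤ n * n := Nat.mul_le_mul_left _ (min_le_right _ _)
    nlinarith
  have h5 : n ^ 3 ≤ 2 ^ (6 * Nat.log 2 n) := by
    calc n ^ 3 ≤ (2 ^ (Nat.log 2 n + 1)) ^ 3 := Nat.pow_le_pow_left h2.le 3
      _ = 2 ^ ((Nat.log 2 n + 1) * 3) := (pow_mul _ _ _).symm
      _ ≤ _ := Nat.pow_le_pow_right (by norm_num) (by omega)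
  rw [announce, Nat.size_eq_bits_len, Nat.size_le]
  exact h3.trans_le h5

open Classical in
/-- The number announced by a message whose sender satisfies `Q`, and `0` otherwise. -/
def tally (v : Fin n) (Q : Fin n → Prop) : Option (Message R) → ℕ
  | none => 0
  | some m => if Q (m.sender v) then m.arg n else 0

namespace Network

variable (net : Network n N) (M : Model)

/-- The box containing `v` of the grid used after `i` stages of the leader election. -/
def gridBox (i : ℕ) (v : Fin n) : ℤ × ℤ := boxCoord (M.pivot / 2 ^ (net.levels M - i)) (net.pos v)

theorem gridBox_levels (v : Fin n) : net.gridBox M (net.levels M) v = net.box M v := by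
  simp [gridBox, box]

/-- According to the messages `g` heard in the first `t` rounds, `v` is the source of least label
in its current box. -/
def Candidate (L : ℕ) (g : ℕ → Option (Message R)) (t : ℕ) (v : Fin n) : Prop :=
  ∀ j < t, ∀ m, g j = some m →
    net.gridBox M (j / L + 1) (m.sender v) = net.gridBox M (j / L + 1) v →
      net.label v ≤ net.label (m.sender v)

/-- The number of sources in the current box of `v`, according to the messages `g`. -/
def sourceCount (L : ℕ) (g : ℕ → Option (Message R)) (t : ℕ) (v : Fin n) : ℕ :=
  1 + ∑ j ∈ Finset.range t, tally v (fun w =>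
    net.gridBox M (j / L + 1) w = net.gridBox M (j / L + 1) v ∧
      net.gridBox M (j / L) w ≠ net.gridBox M (j / L) v) (g j)

/-- The rank of `v` among the sources in its current box, according to the messages `g`. -/
def sourceRank (L : ℕ) (g : ℕ → Option (Message R)) (t : ℕ) (v : Fin n) : ℕ :=
  ∑ j ∈ Finset.range t, tally v (fun w =>
    net.gridBox M (j / L + 1) w = net.gridBox M (j / L + 1) v ∧
      toLex (net.gridBox M (j / L) w) < toLex (net.gridBox M (j / L) v)) (g j)

open Classical in
/-- The transmission of the source `v` in round `t` of the leader election. -/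
def electMessage (d : ℕ) (g : ℕ → Option (Message R)) (t : ℕ) (v : Fin n) : Option (Message R) :=
  if net.Candidate M (d ^ 2) g (d ^ 2 * (t / d ^ 2)) v ∧
      t % d ^ 2 = residueSlot d (net.gridBox M (t / d ^ 2) v)
  then some (announce v (net.sourceCount M (d ^ 2) g (d ^ 2 * (t / d ^ 2)) v) none) else none

/-- The source `v` of rank `r` in its box may transmit its rumors in step `s` of the gathering,
where `g` are the messages heard in the earlier steps. -/
def Turn (g : ℕ → Option (Message R)) (r : ℕ) (v : Fin n) (s : ℕ) : Prop :=
  r = 0 ∨ ∃ j < s, ∃ m, g j = some m ∧ net.box M (m.sender v) = net.box M v ∧ m.arg n = r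

open Classical in
/-- The number of rumors that `v` has transmitted before step `s` of the gathering. -/
def progress (g : ℕ → Option (Message R)) (r : ℕ) (v : Fin n) (s : ℕ) : ℕ :=
  ((Finset.range s).filter fun j => net.Turn M g r v j).card

open Classical in
/-- The transmission of the source `v` of rank `r`, with list of rumors `l`, in step `s` of the
gathering. -/
def gatherMessage (g : ℕ → Option (Message R)) (r : ℕ) (l : List R) (v : Fin n) (s : ℕ) :
    Option (Message R) :=
  if net.Turn M g r v s then
    l[net.progress M g r v s]?.map fun x =>
      announce v (if net.progress M g r v s + 1 = l.length then r + 1 else 0) (some x)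
  else none

variable {net M}

section congr

variable {g g' : ℕ → Option (Message R)} {t : ℕ} (h : ∀ j < t, g j = g' j)
include h

theorem candidate_congr (L : ℕ) (v : Fin n) :
    net.Candidate M L g t v ↔ net.Candidate M L g' t v :=
  forall₂_congr fun j hj => by rw [h j hj]

theorem sourceCount_congr (L : ℕ) (v : Fin n) :
    net.sourceCount M L g t v = net.sourceCount M L g' t v := by
  rw [sourceCount, sourceCount]
  exact congrArg _ (Finset.sum_congr rfl fun j hj => by rw [h j (Finset.mem_range.1 hj)])

theorem sourceRank_congr (L : ℕ) (v : Fin n) :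
    net.sourceRank M L g t v = net.sourceRank M L g' t v :=
  Finset.sum_congr rfl fun j hj => by rw [h j (Finset.mem_range.1 hj)]

theorem electMessage_congr (d : ℕ) (v : Fin n) :
    net.electMessage M d g t v = net.electMessage M d g' t v := by
  have h' : ∀ j < d ^ 2 * (t / d ^ 2), g j = g' j := fun j hj =>
    h j (hj.trans_le (Nat.mul_div_le _ _))
  rw [electMessage, electMessage, candidate_congr h', sourceCount_congr h']

theorem turn_congr (r : ℕ) (v : Fin n) : net.Turn M g r v t ↔ net.Turn M g' r v t :=
  or_congr_right (exists_congr fun j => and_congr_right fun hj => by rw [h j hj])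

theorem progress_congr (r : ℕ) (v : Fin n) :
    net.progress M g r v t = net.progress M g' r v t := by
  classical
  rw [progress, progress]
  exact congrArg _ (Finset.filter_congr fun j hj =>
    turn_congr (fun i hi => h i (hi.trans (Finset.mem_range.1 hj))) r v)

theorem gatherMessage_congr (r : ℕ) (l : List R) (v : Fin n) :
    net.gatherMessage M g r l v t = net.gatherMessage M g' r l v t := by
  rw [gatherMessage, gatherMessage, turn_congr h, progress_congr h]

end congr

end Network

/-- The rumors known to a station that holds `A` initially and hears `g`, after `t` rounds. -/
def learned (A : Set R) (g : ℕ → Option (Message R)) (t : ℕ) : Set R :=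
  A ∪ {x | ∃ j < t, ∃ m, g j = some m ∧ m.rumor = some x}

theorem learned_mono (A : Set R) (g : ℕ → Option (Message R)) {t t' : ℕ} (h : t ≤ t') :
    learned A g t ⊆ learned A g t' :=
  Set.union_subset_union_right _ fun _ ⟨j, hj, hx⟩ => ⟨j, hj.trans_le h, hx⟩

theorem learned_congr (A : Set R) {g g' : ℕ → Option (Message R)} {t : ℕ}
    (h : ∀ j < t, g j = g' j) : learned A g t = learned A g' t := by
  rw [learned, learned]
  congr 1
  ext x
  exact exists_congr fun j => and_congr_right fun hj => by rw [h j hj]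

open Classical in
/-- An element of a set, if there is one. -/
def pick (A : Set R) : Option R := if h : A.Nonempty then some h.choose else none

theorem pick_mem {A : Set R} {x : R} (h : pick A = some x) : x ∈ A := by
  rw [pick] at h
  split_ifs at h with h'
  rw [← Option.some.inj h]
  exact h'.choose_spec

theorem exists_pick {A : Set R} (h : A.Nonempty) : ∃ x, pick A = some x := ⟨_, dif_pos h⟩

/-- The rumors forwarded in the first steps by a station that knows `K s` at the start of
step `s` and forwards any known rumor that it has not yet forwarded. -/
def forwarded (K : ℕ → Set R) : ℕ → Set R
  | 0 => ∅
  | s + 1 => forwarded K s ∪ {x | pick (K s \ forwarded K s) = some x}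

theorem forwarded_congr {K K' : ℕ → Set R} {s : ℕ} (h : ∀ j < s, K j = K' j) :
    forwarded K s = forwarded K' s := by
  induction s with
  | zero => rfl
  | succ s ih => rw [forwarded, forwarded, ih fun j hj => h j (hj.trans s.lt_succ_self),
      h s s.lt_succ_self]

/-- The message in which a rumor is forwarded in step `s`. -/
def relayMessage (K : ℕ → Set R) (s : ℕ) : Option (Message R) :=
  (pick (K s \ forwarded K s)).map fun x => ⟨some x, []⟩

theorem relayMessage_congr {K K' : ℕ → Set R} {s : ℕ} (h : ∀ j ≤ s, K j = K' j) :
    relayMessage K s = relayMessage K' s := by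
  rw [relayMessage, relayMessage, h s le_rfl, forwarded_congr fun j hj => h j hj.le]

open Classical in
/-- The elements of a finite set in some order. -/
def rumorList (A : Set R) : List R := if h : A.Finite then h.toFinset.toList else []

theorem mem_of_mem_rumorList {A : Set R} {x : R} (h : x ∈ rumorList A) : x ∈ A := by
  rw [rumorList] at h
  split_ifs at h with h'
  · simpa using h
  · simp at h

namespace Network

variable (net : Network n N) (M : Model)

/-- The length of the leader election. -/
def electEnd (d : ℕ) : ℕ := d ^ 2 * net.levels M

/-- The end of the gathering. -/
def gatherEnd (d k : ℕ) : ℕ := net.electEnd M d + d ^ 2 * k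

/-- The length of a step of the dissemination. -/
def relayPeriod (d : ℕ) : ℕ := 51 * d ^ 2

/-- The end of the dissemination. -/
def relayEnd (d k : ℕ) : ℕ :=
  net.gatherEnd M d k + relayPeriod d * (5 * (net.commGraph M).diam + k)

open Classical in
/-- The transmission of `v` in round `t`, if `v` holds the rumors `A` initially and hears `g`. -/
def transmission (d k : ℕ) (v : Fin n) (A : Set R) (g : ℕ → Option (Message R)) (t : ℕ) :
    Option (Message R) :=
  if t < net.electEnd M d then
    if A.Nonempty then net.electMessage M d g t v else none
  else if t < net.gatherEnd M d k then
    if A.Nonempty ∧ (t - net.electEnd M d) % d ^ 2 = residueSlot d (net.box M v) then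
      net.gatherMessage M
        (fun j => g (net.electEnd M d + (d ^ 2 * j + residueSlot d (net.box M v))))
        (net.sourceRank M (d ^ 2) g (net.electEnd M d) v) (rumorList A) v
        ((t - net.electEnd M d) / d ^ 2)
    else none
  else if t < net.relayEnd M d k then
    if v ∈ net.backbone M ∧
        (t - net.gatherEnd M d k) % relayPeriod d = net.backboneSlot M d v then
      relayMessage (fun s => learned A g (net.gatherEnd M d k + relayPeriod d * s))
        ((t - net.gatherEnd M d k) / relayPeriod d)
    else none
  else none

/-- The multicast protocol, with dilution factor `d`. -/
def protocol (R : Type) (d k : ℕ) : Protocol n R where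
  transmit v w := net.transmission M d k v w.initial (fun j => w.received.getD j none)
    w.received.length
  active v w := w.initial.Nonempty ∧
    net.Candidate M (d ^ 2) (fun j => w.received.getD j none) w.received.length v
  backbone _ _ := net.backbone M

variable {net M}

/-- Causality: only messages of earlier rounds are read. Hence the finite list of receptions, padded
by `none`, can be replaced by the sequence of all receptions in the run. -/
theorem transmission_congr {g g' : ℕ → Option (Message R)} {t : ℕ} (h : ∀ j < t, g j = g' j)
    (d k : ℕ) (v : Fin n) (A : Set R) :
    net.transmission M d k v A g t = net.transmission M d k v A g' t := by
  rw [transmission, transmission]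
  split_ifs with h1 h2 h3 h4 h5 h6
  · exact electMessage_congr h d v
  · rfl
  · have h7 := Nat.mod_add_div (t - net.electEnd M d) (d ^ 2)
    rw [h4.2] at h7
    rw [sourceRank_congr fun j hj => h j (by omega)]
    apply gatherMessage_congr
    intro j hj
    apply h
    have := Nat.mul_le_mul_left (d ^ 2) (Nat.succ_le_of_lt hj)
    rw [Nat.succ_eq_add_one, mul_add, mul_one] at this
    -- If `d = 0`, division by zero makes the step number `0`, so there is no earlier step `j`.
    rcases Nat.eq_zero_or_pos (d ^ 2) with h0 | h0
    · rw [h0] at hj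
      simp at hj
    · have h8 : residueSlot d (net.box M v) < d ^ 2 := h4.2 ▸ Nat.mod_lt _ h0
      omega
  · rfl
  · apply relayMessage_congr
    intro s hs
    apply learned_congr
    intro j hj
    apply h
    have h7 := Nat.mul_div_le (t - net.gatherEnd M d k) (relayPeriod d)
    have := Nat.mul_le_mul_left (relayPeriod d) hs
    omega
  · rfl
  · rfl

end Network

namespace Protocol

variable {k : ℕ} (P : Protocol n R) (net : Network n N) (M : Model) (I : Input n k R)

/-- What `v` receives in round `t`. -/
def heard (v : Fin n) (t : ℕ) : Option (Message R) := reception net M (P.sent net M I t) v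

theorem length_history (t : ℕ) (v : Fin n) : (P.history net M I t v).length = t := by
  induction t with
  | zero => rfl
  | succ t ih => rw [history, List.length_append, ih, List.length_singleton]

theorem history_eq_map (t : ℕ) (v : Fin n) :
    P.history net M I t v = (List.range t).map (P.heard net M I v) := by
  induction t with
  | zero => rfl
  | succ t ih => rw [List.range_succ, List.map_append, ← ih]; rfl

theorem getD_history {j t : ℕ} (hj : j < t) (v : Fin n) :
    (P.history net M I t v).getD j none = P.heard net M I v j := by
  rw [history_eq_map, List.getD_eq_getElem _ _ (by simpa using hj)]
  simp

theorem mem_history {t : ℕ} {v : Fin n} {m : Option (Message R)} :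
    m ∈ P.history net M I t v ↔ ∃ j < t, P.heard net M I v j = m := by
  simp [history_eq_map]

theorem known_eq_learned (t : ℕ) (v : Fin n) :
    P.known net M I t v = learned (I.initial v) (P.heard net M I v) t := by
  rw [known, learned]
  congr 1
  ext x
  simp only [mem_history, Set.mem_ofPred_eq]
  constructor
  · rintro ⟨m, ⟨j, hj, h⟩, hx⟩
    exact ⟨j, hj, m, h, hx⟩
  · rintro ⟨j, hj, m, h, hx⟩
    exact ⟨m, ⟨j, hj, h⟩, hx⟩

variable {net M}

/-- The choice in `reception` is harmless, because at most one transmission can be received. -/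
theorem reception_eq_of_receives {sent : Fin n → Option (Message R)} {v u : Fin n}
    (h : net.Receives M (Finset.univ.filter fun w => (sent w).isSome = true) v u) :
    reception net M sent u = sent v := by
  classical
  have h' : ∃ v, net.Receives M (Finset.univ.filter fun w => (sent w).isSome = true) v u := ⟨v, h⟩
  rw [reception, dif_pos h']
  exact congrArg sent (h'.choose_spec.unique h)

theorem exists_of_reception_eq_some {sent : Fin n → Option (Message R)} {u : Fin n}
    {m : Message R} (h : reception net M sent u = some m) :
    ∃ v, v ≠ u ∧ sent v = some m := by
  classical
  rw [reception] at h
  split_ifs at h with h'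
  refine ⟨_, ?_, h⟩
  intro heq
  apply h'.choose_spec.2.1
  convert h'.choose_spec.1
  exact heq.symm

theorem reception_eq_of_dilution {d : ℕ} (hd : 0 < d) (hsuf : SufficientDilution M d)
    {sent : Fin n → Option (Message R)} {s : ℝ} (hs : 0 < s)
    (hone : ∀ w w', sent w ≠ none → sent w' ≠ none →
      boxCoord s (net.pos w) = boxCoord s (net.pos w') → w = w')
    (hres : ∀ w w', sent w ≠ none → sent w' ≠ none →
      residueSlot d (boxCoord s (net.pos w)) = residueSlot d (boxCoord s (net.pos w')))
    {v u : Fin n} (hv : sent v ≠ none) (huv : u ≠ v)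
    (hr : dist (net.pos v) (net.pos u) ≤ M.range)
    (h3 : dist (net.pos v) (net.pos u) ≤ 3 * s) : reception net M sent u = sent v := by
  have key : ∀ w, w ∈ Finset.univ.filter (fun w => (sent w).isSome = true) ↔ sent w ≠ none := by
    intro w
    simp [Option.isSome_iff_ne_none]
  apply reception_eq_of_receives
  refine hsuf n N net s _ v u hs ?_ ?_ ((key v).2 hv) huv hr h3
  · intro w hw w' hw'
    exact hone w w' ((key w).1 hw) ((key w').1 hw')
  · intro w hw w' hw'
    exact modEq_of_residueSlot_eq hd (hres w w' ((key w).1 hw) ((key w').1 hw'))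

end Protocol

namespace Network

variable {net : Network n N} {M : Model} {d k : ℕ} {I : Input n k R}

theorem initial_nonempty_iff {v : Fin n} : (I.initial v).Nonempty ↔ v ∈ I.sources :=
  ⟨fun ⟨_, i, hi, _⟩ => ⟨i, hi⟩, fun ⟨i, hi⟩ => ⟨_, i, hi, rfl⟩⟩

theorem learned_empty_of_asleep {g : ℕ → Option (Message R)} {A : Set R} (hA : ¬ A.Nonempty)
    {t : ℕ} (hg : ∀ j < t, g j = none) {x : R} : x ∉ learned A g t := by
  rintro (h | ⟨j, hj, m, hm, -⟩)
  · exact hA ⟨x, h⟩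
  · rw [hg j hj] at hm
    cases hm

/-- A sleeping station is no source and knows no rumor to forward, so the wake-up rule never
suppresses anything. This lets `sent_protocol` do without that rule. -/
theorem transmission_eq_none_of_asleep {g : ℕ → Option (Message R)} {A : Set R}
    (hA : ¬ A.Nonempty) {t : ℕ} (hg : ∀ j < t, g j = none) (v : Fin n) :
    net.transmission M d k v A g t = none := by
  simp only [transmission, hA, false_and, if_false]
  split_ifs with h1 h3 h5 h6
  any_goals rfl
  · rw [relayMessage, Option.map_eq_none_iff, Option.eq_none_iff_forall_ne_some]
    intro x hx
    refine learned_empty_of_asleep hA (fun j hj => hg j ?_) (pick_mem hx).1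
    have := Nat.mul_div_le (t - net.gatherEnd M d k) (relayPeriod d)
    omega

theorem sent_protocol (t : ℕ) (v : Fin n) :
    (net.protocol M R d k).sent net M I t v =
      net.transmission M d k v (I.initial v) ((net.protocol M R d k).heard net M I v) t := by
  have h : ∀ j < t, ((net.protocol M R d k).history net M I t v).getD j none =
      (net.protocol M R d k).heard net M I v j := fun j hj => Protocol.getD_history _ _ _ _ hj v
  rw [Protocol.sent, Protocol.action]
  split_ifs with hw
  · simp only [protocol] at h ⊢
    rw [Protocol.length_history]
    exact transmission_congr h d k v _
  · symm
    rw [not_or] at hw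
    apply transmission_eq_none_of_asleep
    · rw [initial_nonempty_iff]
      exact hw.1
    · intro j hj
      rw [Option.eq_none_iff_forall_ne_some]
      intro m hm
      exact hw.2 ⟨m, (Protocol.mem_history _ _ _ _).2 ⟨j, hj, hm⟩⟩

theorem active_protocol (t : ℕ) (v : Fin n) :
    (net.protocol M R d k).active v ((net.protocol M R d k).view net M I t v) ↔
      v ∈ I.sources ∧
        net.Candidate M (d ^ 2) ((net.protocol M R d k).heard net M I v) t v := by
  have h : ∀ j < t, ((net.protocol M R d k).history net M I t v).getD j none =
      (net.protocol M R d k).heard net M I v j := fun j hj => Protocol.getD_history _ _ _ _ hj v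
  rw [← initial_nonempty_iff, Protocol.view]
  simp only [protocol] at h ⊢
  rw [Protocol.length_history]
  exact and_congr_right fun _ => candidate_congr h _ v

theorem unitSize_protocol (hn : 2 ≤ n) : (net.protocol M R d k).UnitSize net M I 6 := by
  intro t v m hm
  rw [sent_protocol, transmission] at hm
  rw [Protocol.known_eq_learned]
  split_ifs at hm with h1 h2 h3 h4 h5 h6
  · rw [electMessage] at hm
    split_ifs at hm
    rw [← Option.some.inj hm]
    exact ⟨length_announce_le hn _ _ _, fun x hx => by simp [announce] at hx⟩
  · rw [gatherMessage] at hm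
    split_ifs at hm
    all_goals
      obtain ⟨x, hx, rfl⟩ := Option.map_eq_some_iff.1 hm
      refine ⟨length_announce_le hn _ _ _, fun y hy => ?_⟩
      rw [← Option.some.inj hy]
      exact .inl (mem_of_mem_rumorList (List.mem_of_getElem? hx))
  · obtain ⟨x, hx, rfl⟩ := Option.map_eq_some_iff.1 hm
    refine ⟨by simp, fun y hy => ?_⟩
    rw [← Option.some.inj hy]
    -- The rumor is chosen among those known at the start of the period, which is no later than the
    -- slot itself.
    refine learned_mono _ _ ?_ (pick_mem hx).1
    have := Nat.mul_div_le (t - net.gatherEnd M d k) (relayPeriod d)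
    omega

theorem mem_backbone_of_sent_ne_none {t : ℕ} (ht : net.gatherEnd M d k ≤ t) {v : Fin n}
    (h : (net.protocol M R d k).sent net M I t v ≠ none) : v ∈ net.backbone M := by
  rw [sent_protocol, transmission] at h
  split_ifs at h with h1 h2 h3 h4 h5 h6
  any_goals exact absurd rfl h
  · exact absurd h1 (by rw [gatherEnd] at ht; omega)
  · omega
  · exact h6.1

theorem mem_sources_of_sent_ne_none {t : ℕ} (ht : t < net.gatherEnd M d k) {v : Fin n}
    (h : (net.protocol M R d k).sent net M I t v ≠ none) : v ∈ I.sources := by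
  rw [sent_protocol, transmission] at h
  rw [← initial_nonempty_iff]
  split_ifs at h with h1 h2 h4
  any_goals exact absurd rfl h
  · exact h2
  · exact h4.1

theorem sent_eq_none {t : ℕ} (ht : net.relayEnd M d k ≤ t) (v : Fin n) :
    (net.protocol M R d k).sent net M I t v = none := by
  rw [sent_protocol, transmission, if_neg, if_neg, if_neg]
  all_goals rw [relayEnd, gatherEnd] at *; omega

end Network

end SINR

/-! ### Leader election: counts and ranks of sources -/

namespace SINR

namespace Network

variable {n N : ℕ} {R : Type} {net : Network n N} {M : Model} {d k : ℕ}

theorem gridBox_succ {i : ℕ} (hi : i < net.levels M) (v : Fin n) :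
    net.gridBox M (i + 1) v = ((net.gridBox M i v).1 / 2, (net.gridBox M i v).2 / 2) := by
  rw [gridBox, gridBox, ← boxCoord_two_mul]
  congr 1
  obtain ⟨j, hj⟩ : ∃ j, net.levels M = i + 1 + j := ⟨net.levels M - (i + 1), by omega⟩
  have h1 : net.levels M - (i + 1) = j := by omega
  have h2 : net.levels M - i = j + 1 := by omega
  rw [h1, h2, pow_succ]
  field_simp

/-- No bound on `i` is needed: beyond the last stage the truncated subtraction keeps the grid fixed.
-/
theorem gridBox_succ_congr {i : ℕ} {u v : Fin n} (h : net.gridBox M i u = net.gridBox M i v) :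
    net.gridBox M (i + 1) u = net.gridBox M (i + 1) v := by
  rcases lt_or_ge i (net.levels M) with hi | hi
  · rw [gridBox_succ hi, gridBox_succ hi, h]
  · have h1 : net.levels M - i = 0 := by omega
    have h2 : net.levels M - (i + 1) = 0 := by omega
    rw [gridBox, gridBox] at h ⊢
    rwa [h2, ← h1]

theorem gridBox_congr_of_le {i j : ℕ} (hij : i ≤ j) {u v : Fin n}
    (h : net.gridBox M i u = net.gridBox M i v) : net.gridBox M j u = net.gridBox M j v := by
  induction hij with
  | refl => exact h
  | step _ ih => exact gridBox_succ_congr ih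

theorem minDist_le {u v : Fin n} (h : u ≠ v) : net.minDist ≤ dist (net.pos u) (net.pos v) :=
  csInf_le ⟨0, by rintro _ ⟨u, v, -, rfl⟩; exact dist_nonneg⟩ ⟨u, v, h, rfl⟩

theorem minDist_pos (hn : 2 ≤ n) : 0 < net.minDist := by
  have hfin : {d | ∃ u v : Fin n, u ≠ v ∧ d = dist (net.pos u) (net.pos v)}.Finite := by
    apply (Set.finite_range fun e : Fin n × Fin n => dist (net.pos e.1) (net.pos e.2)).subset
    rintro _ ⟨u, v, -, rfl⟩
    exact ⟨(u, v), rfl⟩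
  have hne : {d | ∃ u v : Fin n, u ≠ v ∧ d = dist (net.pos u) (net.pos v)}.Nonempty :=
    ⟨_, ⟨0, by omega⟩, ⟨1, by omega⟩, by simp, rfl⟩
  obtain ⟨u, v, huv, h⟩ := hne.csInf_mem hfin
  rw [minDist, h]
  exact dist_pos.2 fun h => huv (net.pos_injective h)

theorem granularity_le : net.granularity M ≤ 2 ^ net.levels M := by
  obtain ⟨i, hi⟩ := pow_unbounded_of_one_lt (net.granularity M) (one_lt_two : (1 : ℝ) < 2)
  exact Nat.sInf_mem (s := {i : ℕ | net.granularity M ≤ 2 ^ i}) ⟨i, hi.le⟩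

theorem one_le_granularity (hn : 2 ≤ n) (hc : (net.commGraph M).Connected) :
    1 ≤ net.granularity M := by
  have : Nontrivial (Fin n) := Fin.nontrivial_iff_two_le.2 hn
  obtain ⟨v, hv⟩ := hc.preconnected.exists_adj_of_nontrivial ⟨0, by omega⟩
  rw [granularity, one_le_div (minDist_pos hn)]
  exact (minDist_le hv.1).trans hv.2

/-- By minimality `2 ^ (m - 1) < g` when `m > 0`; for `m = 0` the bound needs `g ≥ 1`, which holds
because some edge exists. -/
theorem levels_le (hn : 2 ≤ n) (hc : (net.commGraph M).Connected) :
    (net.levels M : ℝ) ≤ Real.logb 2 (net.granularity M) + 1 := by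
  have hg := one_le_granularity hn hc
  rcases Nat.eq_zero_or_pos (net.levels M) with h | h
  · rw [h]
    have := Real.logb_nonneg (one_lt_two : (1 : ℝ) < 2) hg
    push_cast
    linarith
  · have h1 : net.levels M - 1 ∉ {i : ℕ | net.granularity M ≤ 2 ^ i} :=
      Nat.notMem_of_lt_sInf (Nat.sub_lt h one_pos)
    have h2 : (2 : ℝ) ^ (net.levels M - 1) < net.granularity M := not_le.1 h1
    rw [← Real.rpow_natCast, ← Real.lt_logb_iff_rpow_lt (by norm_num) (by linarith),
      Nat.cast_sub h] at h2
    push_cast at h2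
    linarith

/-- The diagonal of a finest box is `range / 2 ^ m`, at most the minimum distance, and half-open
boxes do not attain their diagonal. -/
theorem eq_of_gridBox_zero_eq (hn : 2 ≤ n) {u v : Fin n}
    (h : net.gridBox M 0 u = net.gridBox M 0 v) : u = v := by
  by_contra huv
  have hp := M.pivot_pos
  have h1 := dist_lt_of_boxCoord_eq (by positivity) h
  have h2 := net.granularity_le (M := M)
  rw [granularity, div_le_iff₀ (minDist_pos hn)] at h2
  have h3 := net.minDist_le huv
  rw [Nat.sub_zero, ← mul_div_assoc, M.sqrt_two_mul_pivot, lt_div_iff₀ (by positivity)] at h1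
  nlinarith [show (0 : ℝ) < 2 ^ net.levels M by positivity]

/-- A merged box lies in a pivotal box, and its diagonal is `2 * √2 ≤ 3` times the side of a subbox.
So dilution at the scale of the subboxes reaches the whole merged box. -/
theorem dist_le_of_gridBox_succ_eq {i : ℕ} (hi : i < net.levels M) {u v : Fin n}
    (h : net.gridBox M (i + 1) u = net.gridBox M (i + 1) v) :
    dist (net.pos u) (net.pos v) ≤ M.range ∧
      dist (net.pos u) (net.pos v) ≤ 3 * (M.pivot / 2 ^ (net.levels M - i)) := by
  refine ⟨net.dist_le_range_of_box_eq M ?_, ?_⟩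
  · rw [← gridBox_levels, ← gridBox_levels]
    exact gridBox_congr_of_le hi h
  · have hp := M.pivot_pos
    obtain ⟨j, hj⟩ : ∃ j, net.levels M = i + 1 + j := ⟨net.levels M - (i + 1), by omega⟩
    have h1 : net.levels M - (i + 1) = j := by omega
    have h2 : net.levels M - i = j + 1 := by omega
    have h3 := dist_lt_of_boxCoord_eq (by positivity) h
    have h4 : √2 ≤ 3 / 2 := by rw [Real.sqrt_le_left (by norm_num)]; norm_num
    rw [h1] at h3
    rw [h2, pow_succ]
    have h5 : 0 < M.pivot / 2 ^ j := by positivity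
    have h6 : 3 * (M.pivot / (2 ^ j * 2)) = 3 / 2 * (M.pivot / 2 ^ j) := by field_simp
    rw [h6]
    nlinarith

/-- Coordinates of siblings differ by at most 1, so congruence modulo `d ≥ 2` forces equality:
siblings never share a slot. -/
theorem gridBox_eq_of_residueSlot_eq (hd : 2 ≤ d) {i : ℕ} (hi : i < net.levels M) {u v : Fin n}
    (h : net.gridBox M (i + 1) u = net.gridBox M (i + 1) v)
    (h' : residueSlot d (net.gridBox M i u) = residueSlot d (net.gridBox M i v)) :
    net.gridBox M i u = net.gridBox M i v := by
  rw [gridBox_succ hi, gridBox_succ hi, Prod.mk.injEq] at h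
  obtain ⟨h1, h2⟩ := modEq_of_residueSlot_eq (by omega) h'
  have hd' : (2 : ℤ) ≤ d := by exact_mod_cast hd
  have key : ∀ a b : ℤ, a / 2 = b / 2 → a ≡ b [ZMOD d] → a = b := by
    intro a b hab hmod
    have h3 := Int.eq_zero_of_abs_lt_dvd hmod.dvd (by rw [abs_lt]; omega)
    omega
  exact Prod.ext (key _ _ h.1 h1) (key _ _ h.2 h2)

/-- The source `w` has the least label among the sources in its box after `i` stages. -/
def IsSourceLeader (net : Network n N) (M : Model) (I : Input n k R) (i : ℕ) (w : Fin n) : Prop :=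
  w ∈ I.sources ∧ ∀ u ∈ I.sources, net.gridBox M i u = net.gridBox M i w → net.label w ≤ net.label u

open Classical in
/-- The sources in the same box as `v` after `i` stages. -/
def boxSources (net : Network n N) (M : Model) (I : Input n k R) (i : ℕ) (v : Fin n) :
    Finset (Fin n) :=
  Finset.univ.filter fun u => u ∈ I.sources ∧ net.gridBox M i u = net.gridBox M i v

variable {I : Input n k R}

@[simp]
theorem mem_boxSources {i : ℕ} {u v : Fin n} : u ∈ net.boxSources M I i v ↔
    u ∈ I.sources ∧ net.gridBox M i u = net.gridBox M i v := by
  simp [boxSources]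

theorem boxSources_congr {i : ℕ} {u v : Fin n} (h : net.gridBox M i u = net.gridBox M i v) :
    net.boxSources M I i u = net.boxSources M I i v := by
  ext x
  rw [mem_boxSources, mem_boxSources, h]

theorem card_boxSources_le (i : ℕ) (v : Fin n) : (net.boxSources M I i v).card ≤ n :=
  (Finset.card_le_univ _).trans (Fintype.card_fin n).le

theorem exists_sourceLeader (i : ℕ) {u : Fin n} (hu : u ∈ I.sources) :
    ∃ w, net.gridBox M i w = net.gridBox M i u ∧ net.IsSourceLeader M I i w := by
  obtain ⟨w, hw, hmin⟩ := Finset.exists_min_image (net.boxSources M I i u) net.label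
    ⟨u, mem_boxSources.2 ⟨hu, rfl⟩⟩
  rw [mem_boxSources] at hw
  exact ⟨w, hw.2, hw.1, fun x hx h => hmin x (mem_boxSources.2 ⟨hx, h.trans hw.2⟩)⟩

theorem IsSourceLeader.unique {i : ℕ} {v w : Fin n} (hv : net.IsSourceLeader M I i v)
    (hw : net.IsSourceLeader M I i w) (h : net.gridBox M i v = net.gridBox M i w) : v = w :=
  net.label_injective (le_antisymm (hv.2 w hw.1 h.symm) (hw.2 v hv.1 h))

/-- What `v` hears in round `t` of the multicast protocol. -/
abbrev heardBy (net : Network n N) (M : Model) (d : ℕ) (I : Input n k R) (v : Fin n) (t : ℕ) :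
    Option (Message R) :=
  (net.protocol M R d k).heard net M I v t

theorem heardBy_eq (v : Fin n) (t : ℕ) : net.heardBy M d I v t =
    Protocol.reception net M ((net.protocol M R d k).sent net M I t) v := rfl

/-- The state of the leader election after `i` stages. -/
def StageInvariant (net : Network n N) (M : Model) (d : ℕ) (I : Input n k R) (i : ℕ) : Prop :=
  ∀ v ∈ I.sources,
    (net.Candidate M (d ^ 2) (net.heardBy M d I v) (d ^ 2 * i) v ↔ net.IsSourceLeader M I i v) ∧
    net.sourceCount M (d ^ 2) (net.heardBy M d I v) (d ^ 2 * i) v = (net.boxSources M I i v).card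

theorem add_lt_electEnd {i q : ℕ} (hi : i < net.levels M) (hq : q < d ^ 2) :
    d ^ 2 * i + q < net.electEnd M d := by
  have := Nat.mul_le_mul_left (d ^ 2) (Nat.succ_le_of_lt hi)
  rw [Nat.succ_eq_add_one, mul_add, mul_one] at this
  rw [electEnd]
  omega

open Classical in
theorem sent_of_stageInvariant {i : ℕ} (hi : i < net.levels M)
    (hinv : net.StageInvariant M d I i) {q : ℕ} (hq : q < d ^ 2) (v : Fin n) :
    (net.protocol M R d k).sent net M I (d ^ 2 * i + q) v =
      if net.IsSourceLeader M I i v ∧ residueSlot d (net.gridBox M i v) = q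
      then some (announce v (net.boxSources M I i v).card none) else none := by
  have h1 : (d ^ 2 * i + q) / d ^ 2 = i := by
    rw [Nat.mul_add_div (by omega), Nat.div_eq_of_lt hq, add_zero]
  have h2 : (d ^ 2 * i + q) % d ^ 2 = q := by rw [Nat.mul_add_mod_self_left, Nat.mod_eq_of_lt hq]
  rw [sent_protocol, transmission, if_pos (add_lt_electEnd hi hq), electMessage, h1, h2,
    initial_nonempty_iff]
  by_cases hv : v ∈ I.sources
  · rw [if_pos hv, (hinv v hv).2]
    exact if_congr (and_congr (hinv v hv).1 eq_comm) rfl rfl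
  · rw [if_neg hv, if_neg fun h => hv h.1.1]

/-- By the invariant the transmitters of this round are leaders of distinct subboxes in one residue
class, which is the situation of `SufficientDilution`. -/
theorem heardBy_of_isSourceLeader (hd : 0 < d) (hsuf : SufficientDilution M d) {i : ℕ}
    (hi : i < net.levels M) (hinv : net.StageInvariant M d I i) {u w : Fin n}
    (hw : net.IsSourceLeader M I i w) (huw : u ≠ w)
    (h : net.gridBox M (i + 1) w = net.gridBox M (i + 1) u) :
    net.heardBy M d I u (d ^ 2 * i + residueSlot d (net.gridBox M i w)) =
      some (announce w (net.boxSources M I i w).card none) := by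
  classical
  have hsent := sent_of_stageInvariant hi hinv (residueSlot_lt hd (net.gridBox M i w))
  have hlead : ∀ x, (net.protocol M R d k).sent net M I
      (d ^ 2 * i + residueSlot d (net.gridBox M i w)) x ≠ none →
      net.IsSourceLeader M I i x ∧
        residueSlot d (net.gridBox M i x) = residueSlot d (net.gridBox M i w) := by
    intro x hx
    rw [hsent] at hx
    by_contra h
    exact hx (if_neg h)
  have hw' := hsent w
  rw [if_pos ⟨hw, rfl⟩] at hw'
  have hp := M.pivot_pos
  obtain ⟨h1, h2⟩ := dist_le_of_gridBox_succ_eq hi h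
  rw [heardBy_eq, ← hw']
  exact Protocol.reception_eq_of_dilution hd hsuf
    (s := M.pivot / 2 ^ (net.levels M - i)) (by positivity)
    (fun x y hx hy hxy => (hlead x hx).1.unique (hlead y hy).1 hxy)
    (fun x y hx hy => (hlead x hx).2.trans (hlead y hy).2.symm)
    (by rw [hw']; simp) huw h1 h2

theorem exists_of_heardBy_stage {i q : ℕ} (hi : i < net.levels M)
    (hinv : net.StageInvariant M d I i) (hq : q < d ^ 2) {u : Fin n} {m : Message R}
    (hm : net.heardBy M d I u (d ^ 2 * i + q) = some m) :
    ∃ w, w ≠ u ∧ net.IsSourceLeader M I i w ∧ residueSlot d (net.gridBox M i w) = q ∧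
      m = announce w (net.boxSources M I i w).card none := by
  classical
  obtain ⟨w, hwu, hw⟩ := Protocol.exists_of_reception_eq_some hm
  rw [sent_of_stageInvariant hi hinv hq] at hw
  split_ifs at hw with h
  exact ⟨w, hwu, h.1, h.2, (Option.some.inj hw).symm⟩

open Classical in
-- The predicate `Q` selects whole siblings of the subbox of `u`. Each selected sibling with a
-- source has its own slot, in which `u` hears the leader announce the number of sources there. The
-- subbox of `u` is excluded since its leader may be `u`, which does not hear itself.
theorem sum_tally_stage (hd : 2 ≤ d) (hsuf : SufficientDilution M d) {i : ℕ}
    (hi : i < net.levels M) (hinv : net.StageInvariant M d I i) (u : Fin n) (Q : Fin n → Prop)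
    (hQ : ∀ w, Q w → net.gridBox M (i + 1) w = net.gridBox M (i + 1) u ∧
      net.gridBox M i w ≠ net.gridBox M i u)
    (hQ' : ∀ w w', net.gridBox M i w = net.gridBox M i w' → Q w → Q w') :
    ∑ q ∈ Finset.range (d ^ 2), tally u Q (net.heardBy M d I u (d ^ 2 * i + q)) =
      (Finset.univ.filter fun x => x ∈ I.sources ∧ Q x).card := by
  rw [Finset.card_eq_sum_card_fiberwise (f := fun x => residueSlot d (net.gridBox M i x))
    (t := Finset.range (d ^ 2))
    fun x _ => Finset.mem_coe.2 (Finset.mem_range.2 (residueSlot_lt (by omega) _))]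
  refine Finset.sum_congr rfl fun q hq => ?_
  rw [Finset.mem_range] at hq
  by_cases hex : ∃ x ∈ I.sources, Q x ∧ residueSlot d (net.gridBox M i x) = q
  · obtain ⟨x, hx, hQx, rfl⟩ := hex
    obtain ⟨w, hwx, hw⟩ := exists_sourceLeader (net := net) (M := M) i hx
    have hQw := hQ' x w hwx.symm hQx
    have hne : u ≠ w := fun h => (hQ w hQw).2 (h ▸ rfl)
    rw [← hwx, heardBy_of_isSourceLeader (by omega) hsuf hi hinv hw hne (hQ w hQw).1, tally,
      sender_announce, if_pos hQw, arg_announce _ (card_boxSources_le _ _)]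
    congr 1
    ext y
    simp only [mem_boxSources, Finset.mem_filter, Finset.mem_univ, true_and]
    constructor
    · rintro ⟨hy, hyw⟩
      exact ⟨⟨hy, hQ' w y hyw.symm hQw⟩, by rw [hyw]⟩
    · rintro ⟨⟨hy, hQy⟩, hslot⟩
      exact ⟨hy, gridBox_eq_of_residueSlot_eq hd hi ((hQ y hQy).1.trans (hQ w hQw).1.symm) hslot⟩
  · have h0 : tally u Q (net.heardBy M d I u (d ^ 2 * i + q)) = 0 := by
      cases hm : net.heardBy M d I u (d ^ 2 * i + q) with
      | none => rfl
      | some m =>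
        obtain ⟨w, -, hw, hslot, rfl⟩ := exists_of_heardBy_stage hi hinv hq hm
        rw [tally, sender_announce, if_neg fun h => hex ⟨w, hw.1, h, hslot⟩]
    rw [h0, eq_comm, Finset.card_eq_zero, Finset.filter_eq_empty_iff]
    intro x hx hslot
    rw [Finset.mem_filter] at hx
    exact hex ⟨x, hx.2.1, hx.2.2, hslot⟩

theorem div_stage {i q : ℕ} (hq : q < d ^ 2) : (d ^ 2 * i + q) / d ^ 2 = i := by
  rw [Nat.mul_add_div (by omega), Nat.div_eq_of_lt hq, add_zero]

theorem sourceCount_succ (hd : 2 ≤ d) (hsuf : SufficientDilution M d) {i : ℕ}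
    (hi : i < net.levels M) (hinv : net.StageInvariant M d I i) {v : Fin n} (hv : v ∈ I.sources) :
    net.sourceCount M (d ^ 2) (net.heardBy M d I v) (d ^ 2 * (i + 1)) v =
      (net.boxSources M I (i + 1) v).card := by
  classical
  rw [sourceCount, mul_add, mul_one, Finset.sum_range_add, ← add_assoc, ← sourceCount,
    (hinv v hv).2]
  have hsum := sum_tally_stage hd hsuf hi hinv v (fun w =>
    net.gridBox M (i + 1) w = net.gridBox M (i + 1) v ∧
      net.gridBox M i w ≠ net.gridBox M i v) (fun w h => h)
    (fun w w' h hw => ⟨(gridBox_succ_congr h).symm.trans hw.1, h ▸ hw.2⟩)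
  rw [Finset.sum_congr rfl fun q hq => by rw [div_stage (Finset.mem_range.1 hq)], hsum,
    ← Finset.card_union_of_disjoint]
  · congr 1
    ext x
    simp only [Finset.mem_union, mem_boxSources, Finset.mem_filter, Finset.mem_univ, true_and]
    constructor
    · rintro (⟨h1, h2⟩ | ⟨h1, h2, -⟩)
      · exact ⟨h1, gridBox_succ_congr h2⟩
      · exact ⟨h1, h2⟩
    · rintro ⟨h1, h2⟩
      by_cases h3 : net.gridBox M i x = net.gridBox M i v
      · exact .inl ⟨h1, h3⟩
      · exact .inr ⟨h1, h2, h3⟩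
  · rw [Finset.disjoint_left]
    intro x hx hx'
    simp only [mem_boxSources, Finset.mem_filter, Finset.mem_univ, true_and] at hx hx'
    exact hx'.2.2 hx.2

/-- Comparing with the leaders of the subboxes suffices, since each is minimal in its own subbox.
Conversely, a leader of the merged box was already the leader of its subbox, and every announcement
in the merged box comes from a source. -/
theorem candidate_succ (hd : 0 < d) (hsuf : SufficientDilution M d) {i : ℕ}
    (hi : i < net.levels M) (hinv : net.StageInvariant M d I i) {v : Fin n} (hv : v ∈ I.sources) :
    net.Candidate M (d ^ 2) (net.heardBy M d I v) (d ^ 2 * (i + 1)) v ↔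
      net.IsSourceLeader M I (i + 1) v := by
  constructor
  · intro h
    refine ⟨hv, fun u hu huv => ?_⟩
    obtain ⟨w, hwu, hw⟩ := exists_sourceLeader (net := net) (M := M) i hu
    refine le_trans ?_ (hw.2 u hu hwu.symm)
    by_cases hvw : v = w
    · rw [hvw]
    · have hwv := (gridBox_succ_congr hwu).trans huv
      have hslot := residueSlot_lt hd (net.gridBox M i w)
      have h1 := h (d ^ 2 * i + residueSlot d (net.gridBox M i w)) (by rw [mul_add]; omega) _
        (heardBy_of_isSourceLeader hd hsuf hi hinv hw hvw hwv)
      rw [div_stage hslot, sender_announce] at h1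
      exact h1 hwv
  · intro h j hj m hm hbox
    have hold : net.Candidate M (d ^ 2) (net.heardBy M d I v) (d ^ 2 * i) v :=
      (hinv v hv).1.2 ⟨hv, fun u hu huv => h.2 u hu (gridBox_succ_congr huv)⟩
    rcases lt_or_ge j (d ^ 2 * i) with hj' | hj'
    · exact hold j hj' m hm hbox
    · obtain ⟨q, rfl⟩ := Nat.exists_eq_add_of_le hj'
      have hq : q < d ^ 2 := by rw [mul_add] at hj; omega
      rw [div_stage hq] at hbox
      obtain ⟨w, -, hw, -, rfl⟩ := exists_of_heardBy_stage hi hinv hq hm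
      rw [sender_announce] at hbox ⊢
      exact h.2 w hw.1 hbox

theorem stageInvariant (hn : 2 ≤ n) (hd : 2 ≤ d) (hsuf : SufficientDilution M d) {i : ℕ}
    (hi : i ≤ net.levels M) : net.StageInvariant M d I i := by
  induction i with
  | zero =>
    intro v hv
    refine ⟨⟨fun _ => ⟨hv, fun u _ huv => by rw [eq_of_gridBox_zero_eq hn huv]⟩,
      fun _ j hj => by simp at hj⟩, ?_⟩
    -- A finest box holds one station; this is the initial `1` in `sourceCount`.
    have : net.boxSources M I 0 v = {v} := by
      ext u
      rw [mem_boxSources, Finset.mem_singleton]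
      exact ⟨fun h => eq_of_gridBox_zero_eq hn h.2, fun h => by rw [h]; exact ⟨hv, rfl⟩⟩
    simp [this, sourceCount]
  | succ i ih =>
    have hinv := ih (by omega)
    exact fun v hv => ⟨candidate_succ (by omega) hsuf hi hinv hv, sourceCount_succ hd hsuf hi hinv hv⟩

theorem electsByGridHalving (hn : 2 ≤ n) (hd : 2 ≤ d) (hsuf : SufficientDilution M d) :
    (net.protocol M R d k).ElectsByGridHalving net M I (d ^ 2) := by
  refine ⟨fun v => ?_, fun i hi v => ?_⟩
  · rw [active_protocol]
    exact ⟨fun h => h.1, fun h => ⟨h, fun j hj => absurd hj (Nat.not_lt_zero j)⟩⟩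
  · rw [active_protocol]
    constructor
    · rintro ⟨hv, h⟩
      exact ((stageInvariant hn hd hsuf hi v hv).1.1 h)
    · intro h
      exact ⟨h.1, (stageInvariant hn hd hsuf hi v h.1).1.2 h⟩

open Classical in
/-- The number of sources in the same box as `v` after `i + 1` stages that are in an earlier
subbox. -/
def sourcesBefore (net : Network n N) (M : Model) (I : Input n k R) (i : ℕ) (v : Fin n) : ℕ :=
  (Finset.univ.filter fun x => x ∈ I.sources ∧ net.gridBox M (i + 1) x = net.gridBox M (i + 1) v ∧
    toLex (net.gridBox M i x) < toLex (net.gridBox M i v)).card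

theorem sourceRank_eq (hn : 2 ≤ n) (hd : 2 ≤ d) (hsuf : SufficientDilution M d) {i : ℕ}
    (hi : i ≤ net.levels M) (v : Fin n) :
    net.sourceRank M (d ^ 2) (net.heardBy M d I v) (d ^ 2 * i) v =
      ∑ j ∈ Finset.range i, net.sourcesBefore M I j v := by
  classical
  induction i with
  | zero => simp [sourceRank]
  | succ i ih =>
    rw [Finset.sum_range_succ, ← ih (by omega), sourceRank, mul_add, mul_one,
      Finset.sum_range_add, ← sourceRank, sourcesBefore]
    have hsum := sum_tally_stage hd hsuf hi (stageInvariant hn hd hsuf (by omega : i ≤ _)) (I := I)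
      v (fun w => net.gridBox M (i + 1) w = net.gridBox M (i + 1) v ∧
        toLex (net.gridBox M i w) < toLex (net.gridBox M i v))
      (fun w h => ⟨h.1, fun h' => h.2.ne (congrArg toLex h')⟩)
      (fun w w' h hw => ⟨(gridBox_succ_congr h).symm.trans hw.1, h ▸ hw.2⟩)
    rw [Finset.sum_congr rfl fun q hq => by rw [div_stage (Finset.mem_range.1 hq)], hsum]
    congr!

theorem card_add_sourcesBefore_le (i : ℕ) (v : Fin n) :
    (net.boxSources M I i v).card + net.sourcesBefore M I i v ≤
      (net.boxSources M I (i + 1) v).card := by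
  classical
  rw [sourcesBefore, ← Finset.card_union_of_disjoint]
  · apply Finset.card_le_card
    intro x hx
    simp only [Finset.mem_union, mem_boxSources, Finset.mem_filter, Finset.mem_univ,
      true_and] at hx ⊢
    rcases hx with ⟨h1, h2⟩ | ⟨h1, h2, -⟩
    · exact ⟨h1, gridBox_succ_congr h2⟩
    · exact ⟨h1, h2⟩
  · rw [Finset.disjoint_left]
    intro x hx hx'
    simp only [mem_boxSources, Finset.mem_filter, Finset.mem_univ, true_and] at hx hx'
    exact hx'.2.2.ne (congrArg toLex hx.2)

/-- The sources in the subbox of `u` and those in siblings before it are disjoint, and all of them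
precede the subbox of `v`. -/
theorem card_add_sourcesBefore_le_of_lt {i : ℕ} {u v : Fin n}
    (h : net.gridBox M (i + 1) u = net.gridBox M (i + 1) v)
    (hlt : toLex (net.gridBox M i u) < toLex (net.gridBox M i v)) :
    (net.boxSources M I i u).card + net.sourcesBefore M I i u ≤ net.sourcesBefore M I i v := by
  classical
  rw [sourcesBefore, sourcesBefore, ← Finset.card_union_of_disjoint]
  · apply Finset.card_le_card
    intro x hx
    simp only [Finset.mem_union, mem_boxSources, Finset.mem_filter, Finset.mem_univ,
      true_and] at hx ⊢
    rcases hx with ⟨h1, h2⟩ | ⟨h1, h2, h3⟩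
    · exact ⟨h1, (gridBox_succ_congr h2).trans h, by rw [h2]; exact hlt⟩
    · exact ⟨h1, h2.trans h, h3.trans hlt⟩
  · rw [Finset.disjoint_left]
    intro x hx hx'
    simp only [mem_boxSources, Finset.mem_filter, Finset.mem_univ, true_and] at hx hx'
    exact hx'.2.2.ne (congrArg toLex hx.2)

/-- The sum is the position of `v` when the sources of each box are listed by concatenating the
lists of its subboxes in lexicographic order; a position is less than the length of the list. -/
theorem sum_sourcesBefore_lt (i : ℕ) {v : Fin n} (hv : v ∈ I.sources) :
    ∑ j ∈ Finset.range i, net.sourcesBefore M I j v < (net.boxSources M I i v).card := by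
  induction i with
  | zero =>
    rw [Finset.sum_range_zero, Finset.card_pos]
    exact ⟨v, mem_boxSources.2 ⟨hv, rfl⟩⟩
  | succ i ih =>
    have := net.card_add_sourcesBefore_le (M := M) (I := I) i v
    rw [Finset.sum_range_succ]
    omega

/-- At the last merging, sources from different subboxes get positions in disjoint blocks; inside
one subbox the same offset is added to both, and induction applies. -/
theorem eq_of_sum_sourcesBefore_eq (hn : 2 ≤ n) (i : ℕ) {u v : Fin n} (hu : u ∈ I.sources)
    (hv : v ∈ I.sources) (hbox : net.gridBox M i u = net.gridBox M i v)
    (h : ∑ j ∈ Finset.range i, net.sourcesBefore M I j u =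
      ∑ j ∈ Finset.range i, net.sourcesBefore M I j v) : u = v := by
  induction i with
  | zero => exact eq_of_gridBox_zero_eq hn hbox
  | succ i ih =>
    rw [Finset.sum_range_succ, Finset.sum_range_succ] at h
    have key : ∀ u v : Fin n, u ∈ I.sources → net.gridBox M (i + 1) u = net.gridBox M (i + 1) v →
        toLex (net.gridBox M i u) < toLex (net.gridBox M i v) →
        ∑ j ∈ Finset.range i, net.sourcesBefore M I j u + net.sourcesBefore M I i u <
          ∑ j ∈ Finset.range i, net.sourcesBefore M I j v + net.sourcesBefore M I i v := by
      intro u v hu hbox hlt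
      have h1 := card_add_sourcesBefore_le_of_lt (I := I) hbox hlt
      have h2 := sum_sourcesBefore_lt (net := net) (M := M) i hu
      omega
    rcases lt_trichotomy (toLex (net.gridBox M i u)) (toLex (net.gridBox M i v)) with h1 | h1 | h1
    · exact absurd h (key u v hu hbox h1).ne
    · have h1 : net.gridBox M i u = net.gridBox M i v := toLex.injective h1
      have h2 : net.sourcesBefore M I i u = net.sourcesBefore M I i v := by
        rw [sourcesBefore, sourcesBefore]
        congr 1
        ext x
        simp only [Finset.mem_filter, hbox, h1]
      exact ih h1 (by omega)
    · exact absurd h (key v u hv hbox.symm h1).ne'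

/-- The rank of `v` among the sources in its box of the pivotal grid. -/
def rank (net : Network n N) (M : Model) (I : Input n k R) (v : Fin n) : ℕ :=
  ∑ j ∈ Finset.range (net.levels M), net.sourcesBefore M I j v

theorem rank_lt {v : Fin n} (hv : v ∈ I.sources) :
    net.rank M I v < (net.boxSources M I (net.levels M) v).card :=
  sum_sourcesBefore_lt _ hv

theorem eq_of_rank_eq (hn : 2 ≤ n) {u v : Fin n} (hu : u ∈ I.sources) (hv : v ∈ I.sources)
    (hbox : net.box M u = net.box M v) (h : net.rank M I u = net.rank M I v) : u = v :=
  eq_of_sum_sourcesBefore_eq hn _ hu hv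
    (by rw [gridBox_levels, gridBox_levels, hbox]) h

/-- Ranks inject the sources of a box into the range of its cardinality, so every smaller value
occurs. -/
theorem exists_rank_eq (hn : 2 ≤ n) {v : Fin n} (hv : v ∈ I.sources) {r : ℕ}
    (hr : r < net.rank M I v) :
    ∃ u ∈ I.sources, net.box M u = net.box M v ∧ net.rank M I u = r := by
  classical
  have hmem : ∀ u ∈ net.boxSources M I (net.levels M) v,
      u ∈ I.sources ∧ net.box M u = net.box M v := by
    intro u hu
    rwa [mem_boxSources, gridBox_levels, gridBox_levels] at hu
  have himage : (net.boxSources M I (net.levels M) v).image (net.rank M I) =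
      Finset.range (net.boxSources M I (net.levels M) v).card := by
    apply Finset.eq_of_subset_of_card_le
    · intro x hx
      obtain ⟨u, hu, rfl⟩ := Finset.mem_image.1 hx
      have h := rank_lt (net := net) (M := M) (hmem u hu).1
      rw [boxSources_congr (mem_boxSources.1 hu).2] at h
      exact Finset.mem_range.2 h
    · rw [Finset.card_range, Finset.card_image_of_injOn]
      intro u hu w hw h
      exact eq_of_rank_eq hn (hmem u hu).1 (hmem w hw).1
        ((hmem u hu).2.trans (hmem w hw).2.symm) h
  have : r ∈ Finset.range (net.boxSources M I (net.levels M) v).card :=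
    Finset.mem_range.2 (hr.trans (rank_lt hv))
  rw [← himage] at this
  obtain ⟨u, hu, rfl⟩ := Finset.mem_image.1 this
  exact ⟨u, (hmem u hu).1, (hmem u hu).2, rfl⟩

end Network

end SINR

/-! ### Gathering: passing the turn in rank order -/

namespace SINR

theorem mem_rumorList {R : Type} {A : Set R} (hA : A.Finite) {x : R} (hx : x ∈ A) :
    x ∈ rumorList A := by
  rw [rumorList, dif_pos hA]
  simpa using hx

namespace Network

variable {n N : ℕ} {R : Type} {net : Network n N} {M : Model} {d k : ℕ} {I : Input n k R}

theorem initial_finite (I : Input n k R) (v : Fin n) : (I.initial v).Finite := by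
  apply (Set.finite_range I.rumor).subset
  rintro _ ⟨i, -, rfl⟩
  exact ⟨i, rfl⟩

open Classical in
theorem length_rumorList_le (I : Input n k R) (v : Fin n) :
    (rumorList (I.initial v)).length ≤ (Finset.univ.filter fun i => I.holder i = v).card := by
  rw [rumorList, dif_pos (initial_finite I v), Finset.length_toList]
  calc _ ≤ ((Finset.univ.filter fun i => I.holder i = v).image I.rumor).card := by
        apply Finset.card_le_card
        intro x hx
        obtain ⟨i, hi, rfl⟩ := (Set.Finite.mem_toFinset _).1 hx
        exact Finset.mem_image_of_mem _ (by simpa using hi)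
    _ ≤ _ := Finset.card_image_le

theorem length_rumorList_pos {v : Fin n} (hv : v ∈ I.sources) :
    0 < (rumorList (I.initial v)).length := by
  obtain ⟨x, hx⟩ := initial_nonempty_iff.2 hv
  exact List.length_pos_of_mem (mem_rumorList (initial_finite I v) hx)

/-- Each of the `k` rumors has a single holder, so it is counted at most once. -/
theorem sum_length_rumorList_le (I : Input n k R) (A : Finset (Fin n)) :
    ∑ v ∈ A, (rumorList (I.initial v)).length ≤ k := by
  classical
  calc _ ≤ ∑ v ∈ A, (Finset.univ.filter fun i => I.holder i = v).card :=
        Finset.sum_le_sum fun v _ => length_rumorList_le I v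
    _ ≤ ∑ v, (Finset.univ.filter fun i => I.holder i = v).card :=
        Finset.sum_le_sum_of_subset (Finset.subset_univ A)
    _ = (Finset.univ : Finset (Fin k)).card :=
        (Finset.card_eq_sum_card_fiberwise fun i _ => by simp).symm
    _ = k := by simp

open Classical in
/-- The sources in the box of `v` that precede `v`. -/
def predecessors (net : Network n N) (M : Model) (I : Input n k R) (v : Fin n) : Finset (Fin n) :=
  Finset.univ.filter fun u => u ∈ I.sources ∧ net.box M u = net.box M v ∧
    net.rank M I u < net.rank M I v

/-- The step of the gathering in which `v` starts to transmit its rumors. -/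
def turnStart (net : Network n N) (M : Model) (I : Input n k R) (v : Fin n) : ℕ :=
  ∑ u ∈ net.predecessors M I v, (rumorList (I.initial u)).length

/-- The step of the gathering before which `v` has transmitted all its rumors. -/
def turnEnd (net : Network n N) (M : Model) (I : Input n k R) (v : Fin n) : ℕ :=
  net.turnStart M I v + (rumorList (I.initial v)).length

theorem mem_predecessors {u v : Fin n} : u ∈ net.predecessors M I v ↔ u ∈ I.sources ∧
    net.box M u = net.box M v ∧ net.rank M I u < net.rank M I v := by
  simp [predecessors]

theorem turnEnd_eq (v : Fin n) : net.turnEnd M I v =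
    ∑ u ∈ insert v (net.predecessors M I v), (rumorList (I.initial u)).length := by
  rw [Finset.sum_insert fun h => lt_irrefl _ (mem_predecessors.1 h).2.2, turnEnd, turnStart,
    add_comm]

theorem turnEnd_le (v : Fin n) : net.turnEnd M I v ≤ k := by
  rw [turnEnd_eq]
  exact sum_length_rumorList_le I _

theorem turnEnd_le_turnStart {u v : Fin n} (hu : u ∈ I.sources) (hbox : net.box M u = net.box M v)
    (h : net.rank M I u < net.rank M I v) : net.turnEnd M I u ≤ net.turnStart M I v := by
  rw [turnEnd_eq, turnStart]
  apply Finset.sum_le_sum_of_subset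
  intro w hw
  rcases Finset.mem_insert.1 hw with rfl | hw
  · exact mem_predecessors.2 ⟨hu, hbox, h⟩
  · obtain ⟨h1, h2, h3⟩ := mem_predecessors.1 hw
    exact mem_predecessors.2 ⟨h1, h2.trans hbox, h3.trans h⟩

/-- Ranks are injective in a box, so no source lies between consecutive ranks and no step is lost
when the turn passes. -/
theorem turnEnd_eq_turnStart (hn : 2 ≤ n) {u v : Fin n} (hu : u ∈ I.sources)
    (hbox : net.box M u = net.box M v) (h : net.rank M I u + 1 = net.rank M I v) :
    net.turnEnd M I u = net.turnStart M I v := by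
  rw [turnEnd_eq, turnStart]
  congr 1
  ext w
  rw [Finset.mem_insert, mem_predecessors, mem_predecessors]
  constructor
  · rintro (rfl | ⟨h1, h2, h3⟩)
    · exact ⟨hu, hbox, by omega⟩
    · exact ⟨h1, h2.trans hbox, by omega⟩
  · rintro ⟨h1, h2, h3⟩
    rcases (by omega : net.rank M I w = net.rank M I u ∨ net.rank M I w < net.rank M I u)
      with h4 | h4
    · exact .inl (eq_of_rank_eq hn h1 hu (h2.trans hbox.symm) h4)
    · exact .inr ⟨h1, h2.trans hbox.symm, h4⟩

theorem turnStart_eq_zero {v : Fin n} (h : net.rank M I v = 0) : net.turnStart M I v = 0 :=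
  Finset.sum_eq_zero fun u hu => by
    have := (mem_predecessors.1 hu).2.2
    omega

theorem eq_of_turns_meet (hn : 2 ≤ n) {u v : Fin n} (hu : u ∈ I.sources) (hv : v ∈ I.sources)
    (hbox : net.box M u = net.box M v) {s : ℕ}
    (hus : net.turnStart M I u ≤ s ∧ s < net.turnEnd M I u)
    (hvs : net.turnStart M I v ≤ s ∧ s < net.turnEnd M I v) : u = v := by
  rcases lt_trichotomy (net.rank M I u) (net.rank M I v) with h | h | h
  · have := turnEnd_le_turnStart hu hbox h
    omega
  · exact eq_of_rank_eq hn hu hv hbox h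
  · have := turnEnd_le_turnStart hv hbox.symm h
    omega

/-- The messages that `v` hears in the slots of the gathering assigned to its box. -/
def heardInBox (net : Network n N) (M : Model) (d : ℕ) (I : Input n k R) (v : Fin n) (j : ℕ) :
    Option (Message R) :=
  net.heardBy M d I v (net.electEnd M d + (d ^ 2 * j + residueSlot d (net.box M v)))

theorem sent_gather_eq (hn : 2 ≤ n) (hd : 2 ≤ d) (hsuf : SufficientDilution M d) {s q : ℕ}
    (hs : s < k) (hq : q < d ^ 2) {v : Fin n} :
    (net.protocol M R d k).sent net M I (net.electEnd M d + (d ^ 2 * s + q)) v =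
      open Classical in if v ∈ I.sources ∧ q = residueSlot d (net.box M v) then
        net.gatherMessage M (net.heardInBox M d I v) (net.rank M I v)
          (rumorList (I.initial v)) v s else none := by
  classical
  have h1 : net.electEnd M d + (d ^ 2 * s + q) < net.gatherEnd M d k := by
    have := Nat.mul_le_mul_left (d ^ 2) (Nat.succ_le_of_lt hs)
    rw [Nat.succ_eq_add_one, mul_add, mul_one] at this
    rw [gatherEnd]
    omega
  rw [sent_protocol, transmission, if_neg (by omega), if_pos h1, Nat.add_sub_cancel_left,
    div_stage hq, Nat.mul_add_mod_self_left, Nat.mod_eq_of_lt hq, initial_nonempty_iff]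
  have h2 := sourceRank_eq (net := net) (I := I) hn hd hsuf le_rfl v
  rw [← electEnd] at h2
  refine if_congr Iff.rfl ?_ rfl
  rw [h2]
  rfl

/-- In the gathering, the turn of `v` has come in step `s` if and only if the preceding sources
have transmitted all their rumors. -/
def TurnInvariant (net : Network n N) (M : Model) (d : ℕ) (I : Input n k R) (s : ℕ) : Prop :=
  ∀ v ∈ I.sources, net.Turn M (net.heardInBox M d I v) (net.rank M I v) v s ↔
    net.turnStart M I v ≤ s

theorem progress_eq {s : ℕ} (hinv : ∀ j < s, net.TurnInvariant M d I j) {v : Fin n}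
    (hv : v ∈ I.sources) : net.progress M (net.heardInBox M d I v) (net.rank M I v) v s =
      s - net.turnStart M I v := by
  classical
  rw [progress, ← Nat.card_Ico]
  congr 1
  ext j
  rw [Finset.mem_filter, Finset.mem_range, Finset.mem_Ico]
  constructor
  · rintro ⟨h1, h2⟩
    exact ⟨(hinv j h1 v hv).1 h2, h1⟩
  · rintro ⟨h1, h2⟩
    exact ⟨h2, (hinv j h2 v hv).2 h1⟩

theorem gatherMessage_eq_none {s : ℕ} (hinv : ∀ j ≤ s, net.TurnInvariant M d I j) {v : Fin n}
    (hv : v ∈ I.sources) (hs : ¬ (net.turnStart M I v ≤ s ∧ s < net.turnEnd M I v)) :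
    net.gatherMessage M (net.heardInBox M d I v) (net.rank M I v) (rumorList (I.initial v)) v s =
      none := by
  rw [gatherMessage, hinv s le_rfl v hv, progress_eq (fun j hj => hinv j hj.le) hv]
  by_cases h : net.turnStart M I v ≤ s
  · rw [if_pos h, List.getElem?_eq_none (by rw [turnEnd] at hs; omega)]
    rfl
  · rw [if_neg h]

theorem gatherMessage_eq_some {s : ℕ} (hinv : ∀ j ≤ s, net.TurnInvariant M d I j) {v : Fin n}
    (hv : v ∈ I.sources) (hs : net.turnStart M I v ≤ s ∧ s < net.turnEnd M I v) :
    net.gatherMessage M (net.heardInBox M d I v) (net.rank M I v) (rumorList (I.initial v)) v s =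
      some (announce v (if s + 1 = net.turnEnd M I v then net.rank M I v + 1 else 0)
        (some ((rumorList (I.initial v))[s - net.turnStart M I v]'(by
          rw [turnEnd] at hs; omega)))) := by
  rw [gatherMessage, if_pos ((hinv s le_rfl v hv).2 hs.1),
    progress_eq (fun j hj => hinv j hj.le) hv,
    List.getElem?_eq_getElem (by rw [turnEnd] at hs; omega), Option.map_some]
  congr 3
  rw [turnEnd, eq_iff_iff]
  omega

theorem exists_of_sent_gather (hn : 2 ≤ n) (hd : 2 ≤ d) (hsuf : SufficientDilution M d) {s q : ℕ}
    (hinv : ∀ j ≤ s, net.TurnInvariant M d I j) (hs : s < k) (hq : q < d ^ 2) {v : Fin n}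
    (h : (net.protocol M R d k).sent net M I (net.electEnd M d + (d ^ 2 * s + q)) v ≠ none) :
    v ∈ I.sources ∧ q = residueSlot d (net.box M v) ∧
      net.turnStart M I v ≤ s ∧ s < net.turnEnd M I v := by
  rw [sent_gather_eq hn hd hsuf hs hq] at h
  split_ifs at h with h1
  · refine ⟨h1.1, h1.2, ?_⟩
    by_contra h2
    exact h (gatherMessage_eq_none hinv h1.1 h2)
  · exact absurd rfl h

/-- Turns in one box are disjoint intervals of steps, so at most one source per box transmits, and
the transmitting boxes share a residue class. -/
theorem heardBy_gather (hn : 2 ≤ n) (hd : 2 ≤ d) (hsuf : SufficientDilution M d) {s : ℕ}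
    (hinv : ∀ j ≤ s, net.TurnInvariant M d I j) {u v : Fin n}
    (hu : u ∈ I.sources) (hbox : net.box M u = net.box M v) (huv : v ≠ u)
    (hus : net.turnStart M I u ≤ s ∧ s < net.turnEnd M I u) :
    net.heardBy M d I v (net.electEnd M d + (d ^ 2 * s + residueSlot d (net.box M u))) =
      net.gatherMessage M (net.heardInBox M d I u) (net.rank M I u)
        (rumorList (I.initial u)) u s := by
  have hs : s < k := hus.2.trans_le (turnEnd_le u)
  have hq := residueSlot_lt (by omega : 0 < d) (net.box M u)
  have hsent := sent_gather_eq (I := I) (net := net) (M := M) hn hd hsuf hs hq (v := u)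
  rw [if_pos ⟨hu, rfl⟩] at hsent
  have hr := net.dist_le_range_of_box_eq M hbox
  rw [heardBy_eq, ← hsent]
  refine Protocol.reception_eq_of_dilution (by omega) hsuf M.pivot_pos ?_ ?_ ?_ huv hr
    (hr.trans (range_le_three_mul_pivot M))
  · intro x y hx hy hxy
    obtain ⟨x1, -, x3⟩ := exists_of_sent_gather hn hd hsuf hinv hs hq hx
    obtain ⟨y1, -, y3⟩ := exists_of_sent_gather hn hd hsuf hinv hs hq hy
    exact eq_of_turns_meet hn x1 y1 hxy x3 y3
  · intro x y hx hy
    exact (exists_of_sent_gather hn hd hsuf hinv hs hq hx).2.1.symm.trans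
      (exists_of_sent_gather hn hd hsuf hinv hs hq hy).2.1
  · rw [hsent, gatherMessage_eq_some hinv hu hus]
    simp

theorem rank_succ_le {v : Fin n} (hv : v ∈ I.sources) : net.rank M I v + 1 ≤ n :=
  (rank_lt hv).trans_le (card_boxSources_le _ _)

/-- Strong induction: the steps before `s` are already known to follow the schedule. A token for `v`
can come only from the source of preceding rank, in the last step of its turn; conversely, that step
is heard by `v`. -/
theorem turnInvariant (hn : 2 ≤ n) (hd : 2 ≤ d) (hsuf : SufficientDilution M d) (s : ℕ)
    (hs : s ≤ k) : net.TurnInvariant M d I s := by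
  induction s using Nat.strong_induction_on with
  | _ s ih =>
    have hinv : ∀ j < s, ∀ i ≤ j, net.TurnInvariant M d I i :=
      fun j hj i hi => ih i (by omega) (by omega)
    intro v hv
    have hq := residueSlot_lt (by omega : 0 < d) (net.box M v)
    constructor
    · rintro (h0 | ⟨j, hj, m, hm, hbox, harg⟩)
      · rw [turnStart_eq_zero h0]
        exact Nat.zero_le s
      · rcases Nat.eq_zero_or_pos (net.rank M I v) with h0 | h0
        · rw [turnStart_eq_zero h0]
          exact Nat.zero_le s
        obtain ⟨w, -, hw⟩ := Protocol.exists_of_reception_eq_some hm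
        obtain ⟨h1, h2, h3⟩ := exists_of_sent_gather hn hd hsuf (hinv j hj) (by omega) hq
          (v := w) (by rw [hw]; simp)
        rw [sent_gather_eq hn hd hsuf (by omega) hq, if_pos ⟨h1, h2⟩,
          gatherMessage_eq_some (hinv j hj) h1 h3] at hw
        rw [← Option.some.inj hw] at hbox harg
        rw [sender_announce] at hbox
        -- Ranks are below `n`, so the cap at `n` in `announce` does not alter the token.
        rw [arg_announce _ (by
          have := rank_succ_le (net := net) (M := M) h1
          split_ifs <;> omega)] at harg
        -- Any message but the last of a turn carries `0`, which is no token for `v` because its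
        -- rank is positive.
        split_ifs at harg with h4
        · rw [← turnEnd_eq_turnStart hn h1 hbox harg]
          omega
        · omega
    · intro hvs
      rcases Nat.eq_zero_or_pos (net.rank M I v) with h0 | h0
      · exact .inl h0
      obtain ⟨u, hu, hbox, hrank⟩ := exists_rank_eq hn hv (Nat.sub_lt h0 one_pos)
      have hrank' : net.rank M I u + 1 = net.rank M I v := by omega
      have hend := turnEnd_eq_turnStart hn hu hbox hrank'
      have hlen := length_rumorList_pos hu
      have hus : net.turnStart M I u ≤ net.turnEnd M I u - 1 ∧
          net.turnEnd M I u - 1 < net.turnEnd M I u := by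
        rw [turnEnd]
        omega
      -- A source holds at least one rumor, so the predecessor's turn is nonempty and its last step
      -- precedes `s`.
      have hlt : net.turnEnd M I u - 1 < s := by omega
      have huv : v ≠ u := by
        rintro rfl
        omega
      have hheard := heardBy_gather hn hd hsuf (hinv _ hlt) hu hbox huv hus
      rw [gatherMessage_eq_some (hinv _ hlt) hu hus, hbox] at hheard
      refine .inr ⟨_, hlt, _, hheard, by rw [sender_announce, hbox], ?_⟩
      rw [if_pos (by omega), arg_announce _ (rank_succ_le hu), hrank']

theorem gathersBy (hn : 2 ≤ n) (hd : 2 ≤ d) (hsuf : SufficientDilution M d) :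
    (net.protocol M R d k).GathersBy net M I (net.gatherEnd M d k) := by
  intro v _ i hbox
  rw [Protocol.known_eq_learned]
  by_cases huv : v = I.holder i
  · exact .inl ⟨i, huv.symm, rfl⟩
  have hu : I.holder i ∈ I.sources := ⟨i, rfl⟩
  obtain ⟨p, hp, hx⟩ := List.getElem_of_mem
    (mem_rumorList (initial_finite I (I.holder i)) ⟨i, rfl, rfl⟩)
  have hs : net.turnStart M I (I.holder i) ≤ net.turnStart M I (I.holder i) + p ∧
      net.turnStart M I (I.holder i) + p < net.turnEnd M I (I.holder i) := by
    rw [turnEnd]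
    omega
  have hsk := hs.2.trans_le (turnEnd_le _)
  have hinv : ∀ j ≤ net.turnStart M I (I.holder i) + p, net.TurnInvariant M d I j :=
    fun j hj => turnInvariant hn hd hsuf j (by omega)
  have hheard := heardBy_gather hn hd hsuf hinv hu hbox huv hs
  rw [gatherMessage_eq_some hinv hu hs] at hheard
  refine .inr ⟨_, ?_, _, hheard, ?_⟩
  · have h1 := residueSlot_lt (by omega : 0 < d) (net.box M (I.holder i))
    have h2 := Nat.mul_le_mul_left (d ^ 2) (Nat.succ_le_of_lt hsk)
    rw [Nat.succ_eq_add_one, mul_add, mul_one] at h2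
    rw [gatherEnd]
    omega
  · simp only [announce, Nat.add_sub_cancel_left, hx]

end Network

end SINR

/-! ### Dissemination: pipelined flooding on the backbone -/

namespace SINR

section forwarded

variable {R : Type} {A : Set R} {X : ℕ}

theorem forwarded_mono (K : ℕ → Set R) {s t : ℕ} (h : s ≤ t) : forwarded K s ⊆ forwarded K t :=
  monotone_nat_of_le_succ (f := forwarded K) (fun _ => Set.subset_union_left) h

theorem forwarded_subset {K : ℕ → Set R} (hK : Monotone K) (s : ℕ) : forwarded K s ⊆ K s := by
  induction s with
  | zero => exact Set.empty_subset _
  | succ s ih =>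
    rintro x (hx | hx)
    · exact hK s.le_succ (ih hx)
    · exact hK s.le_succ (pick_mem hx).1

/-- In each step in which some known rumor has not been forwarded, one more is forwarded. -/
theorem mem_or_le_ncard_forwarded {K : ℕ → Set R} (hK : Monotone K) (hKA : ∀ s, K s ⊆ A)
    (hA : A.Finite) {x : R} {i : ℕ}
    (h : ∀ j, i + j < X → x ∉ forwarded K (i + j) → (forwarded K (i + j)).ncard ≤ j →
      (K (i + j) \ forwarded K (i + j)).Nonempty) (j : ℕ) (hj : i + j ≤ X) :
    x ∈ forwarded K (i + j) ∨ j ≤ (forwarded K (i + j)).ncard := by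
  induction j with
  | zero => exact .inr (Nat.zero_le _)
  | succ j ih =>
    have hmono := forwarded_mono K (i + j).le_succ
    have hfin : (forwarded K (i + (j + 1))).Finite :=
      hA.subset ((forwarded_subset hK _).trans (hKA _))
    rcases ih (by omega) with h1 | h1
    · exact .inl (hmono h1)
    · by_cases hx : x ∈ forwarded K (i + j)
      · exact .inl (hmono hx)
      right
      rcases Nat.lt_or_ge j (forwarded K (i + j)).ncard with h2 | h2
      · exact Nat.succ_le_of_lt (h2.trans_le (Set.ncard_le_ncard hmono hfin))
      -- The count has not yet passed `j`, so the hypothesis gives an unforwarded known rumor, and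
      -- picking one raises the count.
      · obtain ⟨y, hy⟩ := exists_pick (h j (by omega) hx h2)
        have hss : forwarded K (i + j) ⊂ forwarded K (i + (j + 1)) :=
          (Set.ssubset_iff_of_subset hmono).2 ⟨y, .inr hy, (pick_mem hy).2⟩
        have := Set.ncard_lt_ncard hss hfin
        omega

variable {V : Type*} {G : SimpleGraph V} {K : V → ℕ → Set R}

/-- The alternative "`x` is forwarded, or at least `j` rumors are" is passed along an edge with a
delay of one step. As long as the next vertex is behind, its predecessor has forwarded something it
has not, so it never idles. -/
theorem mem_or_le_ncard_forwarded_of_walk (hK : ∀ v, Monotone (K v)) (hKA : ∀ v s, K v s ⊆ A)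
    (hA : A.Finite)
    (hadj : ∀ u v, G.Adj u v → ∀ s ≤ X, forwarded (K u) s ⊆ K v s) {x : R} {u v : V}
    (p : G.Walk u v) {i : ℕ}
    (h : ∀ j, i + j ≤ X → x ∈ forwarded (K u) (i + j) ∨ j ≤ (forwarded (K u) (i + j)).ncard)
    (j : ℕ) (hj : i + p.length + j ≤ X) : x ∈ forwarded (K v) (i + p.length + j) ∨
      j ≤ (forwarded (K v) (i + p.length + j)).ncard := by
  induction p generalizing i with
  | nil => exact h j hj
  | @cons a b c hab p ih =>
    have hlen : i + (SimpleGraph.Walk.cons hab p).length + j = i + 1 + p.length + j := by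
      rw [SimpleGraph.Walk.length_cons]
      ring
    rw [hlen] at hj ⊢
    refine ih (mem_or_le_ncard_forwarded (hK b) (hKA b) hA fun j' hj' hx hcard => ?_) hj
    have hsub := hadj a b hab (i + 1 + j') hj'.le
    have heq : i + (j' + 1) = i + 1 + j' := by ring
    rcases h (j' + 1) (by omega) with h1 | h1
    · rw [heq] at h1
      exact ⟨x, hsub h1, hx⟩
    · rw [heq] at h1
      -- The predecessor has forwarded strictly more rumors, so one of them is new for `b`.
      obtain ⟨y, hy, hy'⟩ := Set.exists_mem_notMem_of_ncard_lt_ncard (hcard.trans_lt h1)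
        (hA.subset ((forwarded_subset (hK b) _).trans (hKA b _)))
      exact ⟨y, hsub hy, hy'⟩

/-- Pipelined flooding: if each vertex forwards to its neighbours any rumor that it has not yet
forwarded, then `k` rumors are forwarded along a walk of length `l` in `l + k` steps. -/
theorem mem_forwarded_of_walk (hK : ∀ v, Monotone (K v)) (hKA : ∀ v s, K v s ⊆ A)
    (hA : A.Finite) (hadj : ∀ u v, G.Adj u v → ∀ s ≤ X, forwarded (K u) s ⊆ K v s)
    {x : R} {u v : V} (hx : x ∈ K u 0) (p : G.Walk u v) (hX : p.length + A.ncard ≤ X) :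
    x ∈ forwarded (K v) X := by
  have h0 : ∀ j, 0 + j ≤ X → x ∈ forwarded (K u) (0 + j) ∨
      j ≤ (forwarded (K u) (0 + j)).ncard :=
    mem_or_le_ncard_forwarded (hK u) (hKA u) hA fun j _ hx' _ => ⟨x, hK u (Nat.zero_le _) hx, hx'⟩
  have h1 := mem_or_le_ncard_forwarded_of_walk hK hKA hA hadj p h0 A.ncard (by omega)
  refine forwarded_mono (K v) (by omega : 0 + p.length + A.ncard ≤ X) ?_
  rcases h1 with h1 | h1
  · exact h1
  -- With `j = A.ncard`, the second alternative means that all of `A` has been forwarded.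
  · rw [Set.eq_of_subset_of_ncard_le ((forwarded_subset (hK v) _).trans (hKA v _)) h1 hA]
    exact hKA u 0 hx

end forwarded

namespace Network

variable {n N : ℕ} {R : Type} {net : Network n N} {M : Model} {d k : ℕ} {I : Input n k R}

/-- The rumors known to `v` at the start of step `s` of the dissemination. -/
def knownAt (net : Network n N) (M : Model) (d : ℕ) (I : Input n k R) (v : Fin n) (s : ℕ) :
    Set R :=
  (net.protocol M R d k).known net M I (net.gatherEnd M d k + relayPeriod d * s) v

theorem knownAt_mono (v : Fin n) : Monotone (net.knownAt M d I v) := by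
  intro s t hst
  rw [knownAt, knownAt, Protocol.known_eq_learned, Protocol.known_eq_learned]
  exact learned_mono _ _ (Nat.add_le_add_left (Nat.mul_le_mul_left _ hst) _)

/-- Senders transmit only rumors they already know, so none is invented; this bounds the pool of the
flooding by `k`. -/
theorem known_subset_range (hn : 2 ≤ n) (t : ℕ) (v : Fin n) :
    (net.protocol M R d k).known net M I t v ⊆ Set.range I.rumor := by
  induction t using Nat.strong_induction_on generalizing v with
  | _ t ih =>
    rw [Protocol.known_eq_learned]
    rintro x (⟨i, -, rfl⟩ | ⟨j, hj, m, hm, hx⟩)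
    · exact ⟨i, rfl⟩
    · obtain ⟨w, -, hw⟩ := Protocol.exists_of_reception_eq_some hm
      exact ih j hj w ((unitSize_protocol hn j w m hw).2 x hx)

theorem sent_relay_eq {s q : ℕ} (hs : s < 5 * (net.commGraph M).diam + k)
    (hq : q < relayPeriod d) (v : Fin n) :
    (net.protocol M R d k).sent net M I (net.gatherEnd M d k + (relayPeriod d * s + q)) v =
      if v ∈ net.backbone M ∧ q = net.backboneSlot M d v then
        relayMessage (net.knownAt M d I v) s else none := by
  have h1 : net.gatherEnd M d k + (relayPeriod d * s + q) < net.relayEnd M d k := by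
    have := Nat.mul_le_mul_left (relayPeriod d) (Nat.succ_le_of_lt hs)
    rw [Nat.succ_eq_add_one, mul_add _ s, mul_one] at this
    rw [relayEnd]
    omega
  have h2 : net.electEnd M d ≤ net.gatherEnd M d k := Nat.le_add_right _ _
  rw [sent_protocol, transmission, if_neg (by omega), if_neg (by omega), if_pos h1,
    Nat.add_sub_cancel_left, Nat.mul_add_mod_self_left, Nat.mod_eq_of_lt hq,
    Nat.mul_add_div (by omega), Nat.div_eq_of_lt hq, add_zero]
  refine if_congr Iff.rfl (congrArg (relayMessage · s) ?_) rfl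
  funext j
  rw [knownAt, Protocol.known_eq_learned]

/-- Every member has a slot in each period, and its transmission there reaches all its neighbours
before the next period starts. -/
theorem forwarded_subset_knownAt (hd : 0 < d) (hsuf : SufficientDilution M d) {u v : Fin n}
    (hu : u ∈ net.backbone M) (huv : (net.commGraph M).Adj u v) {s : ℕ}
    (hs : s ≤ 5 * (net.commGraph M).diam + k) :
    forwarded (net.knownAt M d I u) s ⊆ net.knownAt M d I v s := by
  classical
  induction s with
  | zero => exact Set.empty_subset _
  | succ s ih =>
    rintro x (hx | hx)
    · exact knownAt_mono v s.le_succ (ih (by omega) hx)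
    · have hq := net.backboneSlot_lt M hd hu
      have hsent := sent_relay_eq (I := I) (net := net) (M := M) (d := d) (s := s) (by omega) hq
      have hmem : ∀ w, w ∈ Finset.univ.filter (fun w => ((net.protocol M R d k).sent net M I
          (net.gatherEnd M d k + (relayPeriod d * s + net.backboneSlot M d u)) w).isSome = true) →
          w ∈ net.backbone M ∧ net.backboneSlot M d u = net.backboneSlot M d w := by
        intro w hw
        rw [Finset.mem_filter, hsent] at hw
        by_contra h
        rw [if_neg h] at hw
        simp at hw
      have hpick : pick (net.knownAt M d I u s \ forwarded (net.knownAt M d I u) s) = some x := hx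
      have hsu := hsent u
      rw [if_pos ⟨hu, rfl⟩, relayMessage, hpick, Option.map_some] at hsu
      have hrec := Protocol.reception_eq_of_receives (net.receives_of_backboneSlot M hd hsuf
        (fun w hw => (hmem w hw).1)
        (fun w hw w' hw' => (hmem w hw).2.symm.trans (hmem w' hw').2)
        (by rw [Finset.mem_filter, hsu]; simp) huv)
      rw [hsu] at hrec
      rw [knownAt, Protocol.known_eq_learned]
      refine .inr ⟨net.gatherEnd M d k + (relayPeriod d * s + net.backboneSlot M d u), ?_, _,
        hrec, rfl⟩
      rw [relayPeriod, mul_add _ s, mul_one]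
      omega

theorem multiBroadcastBy (hn : 2 ≤ n) (hd : 2 ≤ d) (hsuf : SufficientDilution M d)
    (hc : (net.commGraph M).Connected) :
    (net.protocol M R d k).MultiBroadcastBy net M I (net.relayEnd M d k) := by
  have hfwd : ∀ (v : ((net.backbone M : Finset (Fin n)) : Set (Fin n))) (i : Fin k),
      I.rumor i ∈ forwarded (net.knownAt M d I v) (5 * (net.commGraph M).diam + k) := by
    intro v i
    obtain ⟨p, hp⟩ := exists_backboneWalk_le_diam hn hc (net.backboneLeader M (I.holder i)) v
    refine mem_forwarded_of_walk (G := net.backboneGraph M)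
      (K := fun v => net.knownAt M d I v.1)
      (A := Set.range I.rumor) (fun v => knownAt_mono v.1)
      (fun v s => known_subset_range hn _ v.1) (Set.finite_range _)
      (fun u v huv s hs => forwarded_subset_knownAt (by omega) hsuf u.2 huv hs) ?_ p ?_
    -- The flooding of a rumor starts at the leader of its holder's box, which has it after the
    -- gathering.
    · exact gathersBy hn hd hsuf _ (net.isBoxLeader_leaderOf M _) i (net.box_leaderOf M _).symm
    · have : (Set.range I.rumor).ncard = k := by
        rw [← Set.image_univ, Set.ncard_image_of_injective _ I.rumor_injective, Set.ncard_univ,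
          Nat.card_fin]
      omega
  intro v i
  change I.rumor i ∈ net.knownAt M d I v (5 * (net.commGraph M).diam + k)
  have hl := hfwd (net.backboneLeader M v) i
  -- A leader knows what it has forwarded; any other station is a neighbour of its leader and has
  -- heard it.
  by_cases hv : net.leaderOf M v = v
  · have h := forwarded_subset (knownAt_mono _) _ hl
    rwa [show (net.backboneLeader M v).1 = v from hv] at h
  · exact forwarded_subset_knownAt (by omega) hsuf (net.leaderOf_mem_backbone M v)
      ⟨hv, net.dist_le_range_of_box_eq M (net.box_leaderOf M v)⟩ le_rfl hl

end Network

end SINR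

end

/-! ### Assembling the phases and constants -/

theorem mainTheorem3 (M : SINR.Model) (p : ℕ) :
    ∃ C L c : ℕ, ∀ R : Type, ∃ 𝒜 : SINR.CentralizedProtocol R,
      ∀ (n N k : ℕ) (net : SINR.Network n N),
        2 ≤ n → N ≤ n ^ p → 1 ≤ k → (net.commGraph M).Connected →
        ∃ (T₁ T₂ T : ℕ) (H : Finset (Fin n)),
          -- number of rounds: in total, and of the three phases
          (T : ℝ) ≤ C * ((net.commGraph M).diam + k + Real.logb 2 (net.granularity M)) ∧
          T₁ = L * net.levels M ∧
          T₁ ≤ T₂ ∧ T₂ ≤ T₁ + C * k ∧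
          T₂ ≤ T ∧ T ≤ T₂ + C * ((net.commGraph M).diam + k) ∧
          net.IsBackbone M C H ∧
          ∀ I : SINR.Input n k R,
            (𝒜 n N net k).UnitSize net M I c ∧
            -- phases 1 and 2 (only sources transmit): leader election, message gathering
            (𝒜 n N net k).ElectsByGridHalving net M I L ∧
            (𝒜 n N net k).GathersBy net M I T₂ ∧
            (∀ t < T₂, ∀ v, (𝒜 n N net k).sent net M I t v ≠ none → v ∈ I.sources) ∧
            -- phase 3 (only the backbone transmits): dissemination to all stations
            (∀ t ≥ T₂, ∀ v, (𝒜 n N net k).sent net M I t v ≠ none → v ∈ H) ∧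
            (𝒜 n N net k).MultiBroadcastBy net M I T ∧
            (∀ t ≥ T, ∀ v, (𝒜 n N net k).sent net M I t v = none) ∧
            (∀ v, (𝒜 n N net k).backbone v ((𝒜 n N net k).view net M I T v) = H) := by
  obtain ⟨d, hd, hsuf⟩ := SINR.exists_sufficientDilution M
  -- The dissemination contributes `51 * 5 = 255` to the coefficient of the diameter; one more
  -- absorbs the `+ 1` in `levels ≤ log g + 1`, because the diameter is at least 1. The coefficient
  -- `52` of `k` and the backbone bound `51 * d ^ 2` are smaller.
  refine ⟨256 * d ^ 2, d ^ 2, 6, fun R => ⟨fun n N net k => net.protocol M R d k, ?_⟩⟩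
  intro n N k net hn _ _ hc
  have hD := SINR.Network.diam_pos hn hc
  refine ⟨net.electEnd M d, net.gatherEnd M d k, net.relayEnd M d k, net.backbone M, ?_, rfl,
    Nat.le_add_right _ _, ?_, Nat.le_add_right _ _, ?_,
    SINR.Network.isBackbone_backbone net M (by omega) hsuf (by omega) hn hc, fun I => ⟨
    SINR.Network.unitSize_protocol hn,
    SINR.Network.electsByGridHalving hn (by omega) hsuf,
    SINR.Network.gathersBy hn (by omega) hsuf,
    fun t ht v => SINR.Network.mem_sources_of_sent_ne_none ht,
    fun t ht v => SINR.Network.mem_backbone_of_sent_ne_none ht,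
    SINR.Network.multiBroadcastBy hn (by omega) hsuf hc,
    fun t ht v => SINR.Network.sent_eq_none ht v, fun v => rfl⟩⟩
  · have hlev := SINR.Network.levels_le hn hc
    have hD' : (1 : ℝ) ≤ (net.commGraph M).diam := by exact_mod_cast hD
    have hlog : 0 ≤ Real.logb 2 (net.granularity M) :=
      Real.logb_nonneg one_lt_two (SINR.Network.one_le_granularity hn hc)
    have hk0 : (0 : ℝ) ≤ k := k.cast_nonneg
    rw [SINR.Network.relayEnd, SINR.Network.gatherEnd, SINR.Network.electEnd,
      SINR.Network.relayPeriod]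
    push_cast
    have hd2 : (0 : ℝ) ≤ (d : ℝ) ^ 2 := by positivity
    calc _ = (d : ℝ) ^ 2 * (net.levels M + k + 51 * (5 * (net.commGraph M).diam + k)) := by ring
      _ ≤ (d : ℝ) ^ 2 * (256 * ((net.commGraph M).diam + k +
          Real.logb 2 (net.granularity M))) := mul_le_mul_of_nonneg_left (by linarith) hd2
      _ = _ := by ring
  · rw [SINR.Network.gatherEnd, mul_assoc]
    have := Nat.zero_le (d ^ 2 * k)
    omega
  · rw [SINR.Network.relayEnd, SINR.Network.relayPeriod]
    have : 51 * d ^ 2 * (5 * (net.commGraph M).diam + k) ≤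
        256 * d ^ 2 * ((net.commGraph M).diam + k) := by
      calc _ = d ^ 2 * (51 * (5 * (net.commGraph M).diam + k)) := by ring
        _ ≤ d ^ 2 * (256 * ((net.commGraph M).diam + k)) := Nat.mul_le_mul_left _ (by omega)
        _ = _ := by ring
    omega
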